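/- Let $V$ be a finite set with $n=|V|\ge 3$ points. For a partition of $V$ into pairwise disjoint classes $C_1,\dots,C_m$ let $\rho_C(x,y)=0$ if some $C_i$ contains both $x$ and $y$, and $\rho_C(x,y)=1$ otherwise. The classifier of $\rho_C$ labels a query $(x,y,z)\in V^3$ by $(x,y^+,z^-)$ if $\rho_C(x,y)<\rho_C(x,z)$, by $(x,z^+,y^-)$ if $\rho_C(x,z)<\rho_C(x,y)$, and by the equality label $(x,y^+,z^+)$ if $\rho_C(x,y)=\rho_C(x,z)$. Let the hypothesis class $\mathcal H$ be either the set of these classifiers for all partitions of $V$ into $m$ classes, empty classes being allowed, where $m\ge 2$ is arbitrary but fixed, or the set of these classifiers for all partitions of $V$ into any number $m\ge 2$ of nonempty classes. Let $\mathcal F\supseteq\mathcal H$ be any set of maps from $V^3$ to the three labels, the permitted outputs of a learning algorithm (e.g. $\mathcal F=\mathcal H$, or all maps). For a probability distribution $\mathcal D$ on labelled queries, the error rate of a classifier is the probability that it mislabels a sample from $\mathcal D$, and $\epsilon^*$ is the smallest error rate over $\mathcal H$. The agnostic sample complexity $S^{a}(\epsilon,\delta)$ is the least $k$ for which there is an algorithm,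 mapping $k$ labelled queries to an element of $\mathcal F$, that for every $\mathcal D$, given $k$ independent samples from $\mathcal D$, outputs with probability at least $1-\delta$ a classifier with error rate at most $\epsilon^*+\epsilon$. The realizable sample complexity $S(\epsilon,\delta)$ is the least $k$ for which this can be done for every $\mathcal D$ with $\epsilon^*=0$. Then $S=\Theta\left(\frac n\epsilon\,\mathrm{polylog}\left(\frac1\epsilon,\frac1\delta\right)\right)$ and $S^{a}=\Theta\left(\frac n{\epsilon^2}\,\mathrm{polylog}\left(\frac1\epsilon,\frac1\delta\right)\right)$ in the following sense. There are absolute constants $c,C>0$, $\epsilon_0,\delta_0\in(0,1)$ and $a\in\mathbb N$ such that for all $V$, $\mathcal H$, $\mathcal F$ as above and all $\epsilon,\delta\in(0,1)$ both sample complexities are finite and $$S(\epsilon,\delta)\le C\,\frac n\epsilon\Big(\big(1+\log\tfrac1\epsilon\big)\big(1+\log\tfrac1\delta\big)\Big)^a,\qquad S^{a}(\epsilon,\delta)\le C\,\frac n{\epsilon^2}\Big(\big(1+\log\tfrac1\epsilon\big)\big(1+\log\tfrac1\delta\big)\Big)^a,$$ and, if in addition $\epsilon\le\epsilon_0$ and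 $\delta\le\delta_0$, $$S(\epsilon,\delta)\ge c\,\frac n\epsilon,\qquad S^{a}(\epsilon,\delta)\ge c\,\frac n{\epsilon^2}.$$ -/

import Mathlib

open MeasureTheory

noncomputable section

namespace Contrastive

/-- A label of the query `(x, y, z)`: `first` is the labelling `(x, y⁺, z⁻)`, `second` is
`(x, z⁺, y⁻)`, and `equal` is the equality label `(x, y⁺, z⁺)`. -/
inductive TripleLabel : Type
  | first
  | second
  | equal
  deriving DecidableEq

instance : Fintype TripleLabel :=
  ⟨{TripleLabel.first, TripleLabel.second, TripleLabel.equal}, fun x => by cases x <;> simp⟩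

instance : MeasurableSpace TripleLabel := ⊤

instance : DiscreteMeasurableSpace TripleLabel := ⟨fun _ => trivial⟩

/-- An unlabelled sample `(x, y, z)`; `x` is the anchor. -/
abbrev Query (V : Type*) : Type _ := V × V × V

/-- A classifier assigns a label to every query. -/
abbrev Classifier (V : Type*) : Type _ := Query V → TripleLabel

/-- A labelled sample. -/
abbrev Sample (V : Type*) : Type _ := Query V × TripleLabel

open Classical in
/-- The classifier of a distance function `ρ`: the query `(x, y, z)` is labelled according to
whether `ρ x y < ρ x z`, `ρ x z < ρ x y` or `ρ x y = ρ x z`. -/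
def distClassifier {V : Type*} (ρ : V → V → ℝ) : Classifier V := fun q =>
  if ρ q.1 q.2.1 < ρ q.1 q.2.2 then TripleLabel.first
  else if ρ q.1 q.2.2 < ρ q.1 q.2.1 then TripleLabel.second
  else TripleLabel.equal

/-- `C 0, …, C (m - 1)` are disjoint classes that cover `V` (some of them may be empty). -/
def IsClassPartition {V : Type*} {m : ℕ} (C : Fin m → Set V) : Prop :=
  (∀ i j, i ≠ j → Disjoint (C i) (C j)) ∧ ⋃ i, C i = Set.univ

open Classical in
/-- The class indicator distance: `0` if `x` and `y` lie in a common class, and `1` otherwise. -/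
def classDist {V : Type*} {m : ℕ} (C : Fin m → Set V) (x y : V) : ℝ :=
  if ∃ i, x ∈ C i ∧ y ∈ C i then 0 else 1

/-- Class distances of the partitions of `V` into `m` classes, empty classes being allowed. -/
def classHypotheses (V : Type*) (m : ℕ) : Set (Classifier V) :=
  {h | ∃ C : Fin m → Set V, IsClassPartition C ∧ h = distClassifier (classDist C)}

/-- Class distances of the partitions of `V` into any number `m ≥ 2` of nonempty classes. -/
def nonemptyClassHypotheses (V : Type*) : Set (Classifier V) :=
  {h | ∃ m : ℕ, 2 ≤ m ∧ ∃ C : Fin m → Set V,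
    IsClassPartition C ∧ (∀ i, (C i).Nonempty) ∧ h = distClassifier (classDist C)}

section Learning

variable {V : Type*} [MeasurableSpace V]

/-- The error rate of a classifier: the probability that it mislabels a new sample. -/
def errorRate (D : Measure (Sample V)) (h : Classifier V) : ℝ :=
  D.real {z | h z.1 ≠ z.2}

/-- The smallest error rate achieved in the hypothesis class `H`. -/
def optimalError (H : Set (Classifier V)) (D : Measure (Sample V)) : ℝ :=
  ⨅ h : H, errorRate D h

/-- From `k` i.i.d. samples of any distribution that is consistent with a hypothesis of `H`, some
fixed algorithm with outputs in `F` finds, with probability at least `1 - δ`, a classifier with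
error rate at most `ε`. -/
def RealizableLearnable (H F : Set (Classifier V)) (ε δ : ℝ) (k : ℕ) : Prop :=
  ∃ A : (Fin k → Sample V) → Classifier V, (∀ s, A s ∈ F) ∧
    ∀ D : Measure (Sample V), IsProbabilityMeasure D → (∃ h ∈ H, errorRate D h = 0) →
      1 - δ ≤ (Measure.pi fun _ : Fin k => D).real {s | errorRate D (A s) ≤ ε}

/-- From `k` i.i.d. samples of any distribution, some fixed algorithm with outputs in `F` finds,
with probability at least `1 - δ`, a classifier whose error rate exceeds the smallest error rate
achieved in `H` by at most `ε`. -/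
def AgnosticLearnable (H F : Set (Classifier V)) (ε δ : ℝ) (k : ℕ) : Prop :=
  ∃ A : (Fin k → Sample V) → Classifier V, (∀ s, A s ∈ F) ∧
    ∀ D : Measure (Sample V), IsProbabilityMeasure D →
      1 - δ ≤ (Measure.pi fun _ : Fin k => D).real
        {s | errorRate D (A s) ≤ optimalError H D + ε}

/-- `s` is the sample complexity in the realizable case. -/
def IsRealizableSampleComplexity (H F : Set (Classifier V)) (ε δ : ℝ) (s : ℕ) : Prop :=
  IsLeast {k | RealizableLearnable H F ε δ k} s

/-- `s` is the sample complexity in the agnostic case. -/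
def IsAgnosticSampleComplexity (H F : Set (Classifier V)) (ε δ : ℝ) (s : ℕ) : Prop :=
  IsLeast {k | AgnosticLearnable H F ε δ k} s

end Learning

end Contrastive

end

open Contrastive

universe u

/-! Upper bounds. A label depends only on whether two pairs of points are equivalent, so a
hypothesis acts on `k` double samples through an equivalence relation restricted to `4k` pairs.
Pairs are edges of a graph on `V`: a pair is related exactly when its edge vector lies in the span
of the edge vectors of the related pairs of the family, and a basis of that span has at most `n`
elements. So the patterns number at most the subsets of size at most `n` of a `4k`-set, hence at
most `exp(4xk) / x^n` for every `x` in `(0, 1]`. Counting partitions instead would cost `n log n`.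
Choosing `x` proportional to `ε` or `ε²` lets the deviation exponent absorb `exp(4xk)` and leaves `n
log(1/ε)`. Ghost-sample symmetrization (`mul_sum_bad_le`) turns this count into uniform bounds
(`sum_consistent_le`, `sum_deviation_le`), and empirical risk minimization over `H` learns.

Lower bounds. With `x` and `z` fixed, the `n - 2` queries `(x, x, y)` are shattered: any set of the
`y` can be joined to `x`. Put mass `θ` uniformly on these queries and reveal their bits with bias
`α`. By Assouad's lemma with Hellinger affinity (`exists_le_expected_errors`), a constant fraction
of the bits stays undetermined while `k θ α²` is small compared with `n`, and the resulting excess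
error is of order `θ α`. Taking `θ α = 16 ε`, the choice `α = 1` is realizable and yields `n/ε`; the
choice `θ = 1` yields `n/ε²`. -/

namespace Contrastive

/-! ### Ghost samples and symmetrization over finite probability spaces -/

section Symmetrization

open Classical in
/-- The real-valued indicator of a proposition. -/
noncomputable def ind (P : Prop) : ℝ := if P then 1 else 0

theorem ind_of {P : Prop} (h : P) : ind P = 1 := if_pos h

theorem ind_of_not {P : Prop} (h : ¬P) : ind P = 0 := if_neg h

theorem ind_nonneg (P : Prop) : 0 ≤ ind P := by
  unfold ind
  split_ifs <;> norm_num

theorem ind_mono {P Q : Prop} (h : P → Q) : ind P ≤ ind Q := by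
  by_cases hP : P
  · rw [ind_of hP, ind_of (h hP)]
  · rw [ind_of_not hP]
    exact ind_nonneg Q

set_option linter.unusedSectionVars false

variable {κ Ω : Type*} [Fintype κ] [DecidableEq κ] [Fintype Ω]

/-- The weight of a tuple of independent draws from the distribution with point weights `p`. -/
def tupleWeight (p : Ω → ℝ) (s : κ → Ω) : ℝ := ∏ i, p (s i)

/-- The probability of `g` under the point weights `p`. -/
def trueRate (p : Ω → ℝ) (g : Ω → Bool) : ℝ := ∑ ω, p ω * (if g ω then 1 else 0)

/-- The frequency of `g` in the tuple `s`. -/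
noncomputable def empRate (g : Ω → Bool) (s : κ → Ω) : ℝ :=
  (∑ i, if g (s i) then (1 : ℝ) else 0) / Fintype.card κ

/-- Exchange the two members of the pairs in the coordinates selected by `σ`. -/
def swapPairs {α : Type*} (σ : κ → Bool) (t : κ → α × α) : κ → α × α :=
  fun i => if σ i then (t i).swap else t i

theorem swapPairs_involutive {α : Type*} (σ : κ → Bool) :
    Function.Involutive (swapPairs (α := α) σ) := by
  intro t
  funext i
  by_cases h : σ i <;> simp [swapPairs, h]

theorem tupleWeight_nonneg {p : Ω → ℝ} (hp : ∀ ω, 0 ≤ p ω) (s : κ → Ω) : 0 ≤ tupleWeight p s :=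
  Finset.prod_nonneg fun _ _ => hp _

theorem sum_prod_apply {α : Type*} [Fintype α] (f : κ → α → ℝ) :
    ∑ s : κ → α, ∏ i, f i (s i) = ∏ i, ∑ a, f i a := by
  rw [Finset.prod_univ_sum, Fintype.piFinset_univ]

theorem sum_tupleWeight {p : Ω → ℝ} (hp : ∑ ω, p ω = 1) :
    ∑ s : κ → Ω, tupleWeight p s = 1 := by
  simp only [tupleWeight]
  rw [sum_prod_apply fun _ => p]
  simp [hp]

theorem sum_tupleWeight_mul_apply {p : Ω → ℝ} (hp : ∑ ω, p ω = 1) (φ : Ω → ℝ) (j : κ) :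
    ∑ s : κ → Ω, tupleWeight p s * φ (s j) = ∑ ω, p ω * φ ω := by
  classical
  have h : ∀ s : κ → Ω, tupleWeight p s * φ (s j)
      = ∏ i, (p (s i) * if i = j then φ (s i) else 1) := by
    intro s
    rw [Finset.prod_mul_distrib, tupleWeight, Finset.prod_ite_eq' Finset.univ j]
    simp
  simp only [h]
  rw [sum_prod_apply fun i ω => p ω * if i = j then φ ω else 1, Finset.prod_eq_single j]
  · simp
  · intro i _ hij
    simp [hij, hp]
  · simp

theorem sum_tupleWeight_mul_empRate [Nonempty κ] {p : Ω → ℝ} (hp : ∑ ω, p ω = 1)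
    (g : Ω → Bool) :
    ∑ s : κ → Ω, tupleWeight p s * empRate g s = trueRate p g := by
  have hκ : (Fintype.card κ : ℝ) ≠ 0 := by exact_mod_cast Fintype.card_ne_zero
  simp only [empRate, mul_div_assoc', ← Finset.sum_div, Finset.mul_sum]
  rw [Finset.sum_comm]
  have h := fun j : κ => sum_tupleWeight_mul_apply hp (fun ω => if g ω then (1 : ℝ) else 0) j
  simp only [h, trueRate]
  rw [Finset.sum_const, Finset.card_univ, nsmul_eq_mul, mul_div_cancel_left₀ _ hκ]

theorem empRate_le_one (g : Ω → Bool) (s : κ → Ω) : empRate g s ≤ 1 := by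
  refine div_le_one_of_le₀ ?_ (by positivity)
  calc _ ≤ ∑ _i : κ, (1 : ℝ) := Finset.sum_le_sum fun i _ => by split_ifs <;> norm_num
    _ = _ := by simp

/-- Reverse Markov inequality: the frequency has mean `trueRate` and is at most 1. The ghost sample
is thus good with probability at least `η`, a weak bound that costs only a logarithm later and needs
no variance estimate. -/
theorem le_sum_tupleWeight_empRate [Nonempty κ] {p : Ω → ℝ} (hp0 : ∀ ω, 0 ≤ p ω)
    (hp : ∑ ω, p ω = 1) (g : Ω → Bool) {η : ℝ} (hη : η ≤ trueRate p g) :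
    η ≤ ∑ s : κ → Ω, tupleWeight p s * ind (trueRate p g - η < empRate g s) := by
  have h : ∑ s : κ → Ω, tupleWeight p s * empRate g s ≤
      ∑ s : κ → Ω, tupleWeight p s *
        ((trueRate p g - η) + ind (trueRate p g - η < empRate g s)) := by
    refine Finset.sum_le_sum fun s _ => mul_le_mul_of_nonneg_left ?_ (tupleWeight_nonneg hp0 s)
    have := empRate_le_one g s
    by_cases h : trueRate p g - η < empRate g s
    · rw [ind_of h]
      linarith
    · rw [ind_of_not h]
      linarith
  rw [sum_tupleWeight_mul_empRate hp] at h
  simp only [mul_add, Finset.sum_add_distrib, ← Finset.sum_mul, sum_tupleWeight hp] at h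
  linarith

/-- Symmetrization: the swap-invariance of a double sample and a union bound over the patterns
that `G` cuts out on it. -/
theorem sum_doubleSample_le {p : Ω → ℝ} (hp0 : ∀ ω, 0 ≤ p ω) (hp : ∑ ω, p ω = 1)
    (G : Set (Ω → Bool)) (w : Bool → Bool → ℝ) (hw : ∀ a b, 0 ≤ w a b) {M N r : ℝ}
    (hM : ∀ a b, w a b + w b a ≤ 2 * M) (hr : 0 < r)
    (hN : ∀ t : κ → Ω × Ω, ∃ U : Finset (κ → Bool × Bool), (U.card : ℝ) ≤ N ∧
      ∀ g ∈ G, (fun i => (g (t i).1, g (t i).2)) ∈ U) :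
    ∑ t : κ → Ω × Ω, (∏ i, p (t i).1 * p (t i).2) *
      ind (∃ g ∈ G, r ≤ ∏ i, w (g (t i).1) (g (t i).2))
      ≤ N * M ^ Fintype.card κ / r := by
  set W : (κ → Ω × Ω) → ℝ := fun t => ∏ i, p (t i).1 * p (t i).2 with hW
  set Φ : (κ → Ω × Ω) → ℝ := fun t =>
    ind (∃ g ∈ G, r ≤ ∏ i, w (g (t i).1) (g (t i).2)) with hΦ
  have hW0 : ∀ t, 0 ≤ W t := fun t => Finset.prod_nonneg fun i _ => mul_nonneg (hp0 _) (hp0 _)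
  have hWsum : ∑ t, W t = 1 := by
    rw [hW, sum_prod_apply fun _ (a : Ω × Ω) => p a.1 * p a.2]
    simp [Fintype.sum_prod_type, ← Finset.mul_sum, hp]
  have hM0 : 0 ≤ M := by nlinarith [hM true true, hw true true]
  have hswapW : ∀ σ t, W (swapPairs σ t) = W t := by
    intro σ t
    refine Finset.prod_congr rfl fun i _ => ?_
    by_cases h : σ i <;> simp [swapPairs, h, mul_comm]
  have hswap : ∀ σ : κ → Bool, ∑ t, W t * Φ (swapPairs σ t) = ∑ t, W t * Φ t := by
    intro σ
    rw [← Equiv.sum_comp (swapPairs_involutive σ).toPerm fun t => W t * Φ t]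
    refine Finset.sum_congr rfl fun t _ => ?_
    simp [hswapW]
  -- For a fixed double sample only the swaps are random. Markov's inequality is applied to each
  -- pattern, and the sum over swaps factorizes into terms `w a b + w b a ≤ 2 * M`.
  have hkey : ∀ t, ∑ σ : κ → Bool, Φ (swapPairs σ t) ≤ N * (2 * M) ^ Fintype.card κ / r := by
    intro t
    obtain ⟨U, hU, hUG⟩ := hN t
    have h1 : ∀ σ, Φ (swapPairs σ t)
        ≤ ∑ u ∈ U, (∏ i, if σ i then w (u i).2 (u i).1 else w (u i).1 (u i).2) / r := by
      intro σ
      have hnn : ∀ u : κ → Bool × Bool,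
          0 ≤ (∏ i, if σ i then w (u i).2 (u i).1 else w (u i).1 (u i).2) / r := fun u =>
        div_nonneg (Finset.prod_nonneg fun i _ => by split_ifs <;> exact hw _ _) hr.le
      simp only [hΦ]
      by_cases h : ∃ g ∈ G, r ≤ ∏ i, w (g (swapPairs σ t i).1) (g (swapPairs σ t i).2)
      · rw [ind_of h]
        obtain ⟨g, hg, hgr⟩ := h
        refine le_trans ?_ (Finset.single_le_sum (fun u _ => hnn u) (hUG g hg))
        rw [le_div_iff₀ hr, one_mul]
        refine hgr.trans (le_of_eq (Finset.prod_congr rfl fun i _ => ?_))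
        by_cases h : σ i <;> simp [swapPairs, h]
      · rw [ind_of_not h]
        exact Finset.sum_nonneg fun u _ => hnn u
    refine (Finset.sum_le_sum fun σ _ => h1 σ).trans ?_
    rw [Finset.sum_comm]
    have h2 : ∀ u ∈ U, ∑ σ : κ → Bool,
        (∏ i, if σ i then w (u i).2 (u i).1 else w (u i).1 (u i).2) / r
          ≤ (2 * M) ^ Fintype.card κ / r := by
      intro u _
      rw [← Finset.sum_div,
        sum_prod_apply fun i (b : Bool) => if b then w (u i).2 (u i).1 else w (u i).1 (u i).2]
      refine div_le_div_of_nonneg_right ?_ hr.le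
      rw [← Finset.card_univ, ← Finset.prod_const]
      refine Finset.prod_le_prod (fun i _ => Finset.sum_nonneg fun b _ => ?_) fun i _ => ?_
      · split_ifs <;> exact hw _ _
      · simpa using hM (u i).2 (u i).1
    refine (Finset.sum_le_sum h2).trans ?_
    rw [Finset.sum_const, nsmul_eq_mul, mul_div_assoc]
    exact mul_le_mul_of_nonneg_right hU (by positivity)
  have h2 : (2 : ℝ) ^ Fintype.card κ * ∑ t, W t * Φ t
      ≤ N * (2 * M) ^ Fintype.card κ / r := by
    calc (2 : ℝ) ^ Fintype.card κ * ∑ t, W t * Φ t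
        = ∑ σ : κ → Bool, ∑ t, W t * Φ (swapPairs σ t) := by
          simp only [hswap, Finset.sum_const, Finset.card_univ, Fintype.card_pi, Fintype.card_bool,
            Finset.prod_const, nsmul_eq_mul, Nat.cast_pow, Nat.cast_ofNat]
      _ = ∑ t, W t * ∑ σ : κ → Bool, Φ (swapPairs σ t) := by
          rw [Finset.sum_comm]
          simp only [Finset.mul_sum]
      _ ≤ ∑ t, W t * (N * (2 * M) ^ Fintype.card κ / r) :=
          Finset.sum_le_sum fun t _ => mul_le_mul_of_nonneg_left (hkey t) (hW0 t)
      _ = _ := by rw [← Finset.sum_mul, hWsum, one_mul]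
  have h3 : N * (2 * M) ^ Fintype.card κ / r
      = 2 ^ Fintype.card κ * (N * M ^ Fintype.card κ / r) := by
    rw [mul_pow]; ring
  rw [h3] at h2
  exact le_of_mul_le_mul_left h2 (by positivity)

/-- The ghost sample bound: the probability that some `g ∈ G` is bad on the sample. -/
theorem mul_sum_bad_le [Nonempty κ] {p : Ω → ℝ} (hp0 : ∀ ω, 0 ≤ p ω) (hp : ∑ ω, p ω = 1)
    (G : Set (Ω → Bool)) (w : Bool → Bool → ℝ) (hw : ∀ a b, 0 ≤ w a b) {M N r η : ℝ}
    (hM : ∀ a b, w a b + w b a ≤ 2 * M) (hr : 0 < r)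
    (hN : ∀ t : κ → Ω × Ω, ∃ U : Finset (κ → Bool × Bool), (U.card : ℝ) ≤ N ∧
      ∀ g ∈ G, (fun i => (g (t i).1, g (t i).2)) ∈ U)
    (bad : (Ω → Bool) → (κ → Ω) → Prop)
    (hbad : ∀ g ∈ G, ∀ s, bad g s → η ≤ trueRate p g ∧
      ∀ s', trueRate p g - η < empRate g s' → r ≤ ∏ i, w (g (s i)) (g (s' i))) :
    η * ∑ s : κ → Ω, tupleWeight p s * ind (∃ g ∈ G, bad g s)
      ≤ N * M ^ Fintype.card κ / r := by
  refine le_trans ?_ (sum_doubleSample_le hp0 hp G w hw hM hr hN)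
  have h1 := Equiv.sum_comp (Equiv.arrowProdEquivProdArrow κ (fun _ => Ω) (fun _ => Ω)).symm
    fun t => (∏ i, p (t i).1 * p (t i).2) *
      ind (∃ g ∈ G, r ≤ ∏ i, w (g (t i).1) (g (t i).2))
  rw [← h1, Fintype.sum_prod_type, Finset.mul_sum]
  refine Finset.sum_le_sum fun s _ => ?_
  have h2 : ∀ s' : κ → Ω, (∏ i, p (s i) * p (s' i)) = tupleWeight p s * tupleWeight p s' :=
    fun s' => Finset.prod_mul_distrib
  simp only [Equiv.arrowProdEquivProdArrow, Equiv.coe_fn_symm_mk, h2]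
  rw [mul_left_comm]
  simp only [mul_assoc]
  rw [← Finset.mul_sum]
  refine mul_le_mul_of_nonneg_left ?_ (tupleWeight_nonneg hp0 s)
  by_cases h : ∃ g ∈ G, bad g s
  · rw [ind_of h, mul_one]
    obtain ⟨g, hg, hgs⟩ := h
    obtain ⟨h3, h4⟩ := hbad g hg s hgs
    refine (le_sum_tupleWeight_empRate (κ := κ) hp0 hp g h3).trans ?_
    exact Finset.sum_le_sum fun s' _ => mul_le_mul_of_nonneg_left
      (ind_mono fun h5 => ⟨g, hg, h4 s' h5⟩) (tupleWeight_nonneg hp0 s')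
  · rw [ind_of_not h, mul_zero]
    exact Finset.sum_nonneg fun s' _ => mul_nonneg (tupleWeight_nonneg hp0 s') (ind_nonneg _)

end Symmetrization

/-! ### Counting the patterns of equivalence relations by linear algebra -/

section Growth

open Classical in
/-- The label of `(x, y, z)` when `P` says that `x, y` are equivalent and `Q` that `x, z` are. -/
noncomputable def pairLabel (P Q : Prop) : TripleLabel :=
  if P ∧ ¬Q then TripleLabel.first else if Q ∧ ¬P then TripleLabel.second else TripleLabel.equal

theorem distClassifier_classDist {V : Type*} {m : ℕ} (C : Fin m → Set V) (q : Query V) :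
    distClassifier (classDist C) q =
      pairLabel (∃ i, q.1 ∈ C i ∧ q.2.1 ∈ C i) (∃ i, q.1 ∈ C i ∧ q.2.2 ∈ C i) := by
  by_cases h1 : ∃ i, q.1 ∈ C i ∧ q.2.1 ∈ C i <;> by_cases h2 : ∃ i, q.1 ∈ C i ∧ q.2.2 ∈ C i <;>
    simp [distClassifier, classDist, pairLabel, h1, h2]

/-- The equivalence relation of a partition into classes. -/
def IsClassPartition.toSetoid {V : Type*} {m : ℕ} {C : Fin m → Set V} (hC : IsClassPartition C) :
    Setoid V where
  r x y := ∃ i, x ∈ C i ∧ y ∈ C i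
  iseqv :=
    { refl := fun x => by
        have hx : x ∈ ⋃ i, C i := hC.2 ▸ Set.mem_univ x
        obtain ⟨i, hi⟩ := Set.mem_iUnion.1 hx
        exact ⟨i, hi, hi⟩
      symm := fun ⟨i, h1, h2⟩ => ⟨i, h2, h1⟩
      trans := by
        rintro x y z ⟨i, h1, h2⟩ ⟨j, h3, h4⟩
        by_cases hij : i = j
        · exact ⟨i, h1, hij ▸ h4⟩
        · exact absurd h3 (Set.disjoint_left.1 (hC.1 i j hij) h2) }

theorem exists_setoid_of_isClassPartition {V : Type*} {m : ℕ} {C : Fin m → Set V}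
    (hC : IsClassPartition C) :
    ∃ S : Setoid V, ∀ q, distClassifier (classDist C) q = pairLabel (S q.1 q.2.1) (S q.1 q.2.2) :=
  ⟨hC.toSetoid, fun q => distClassifier_classDist C q⟩

/-- The difference of the basis vectors at the two ends of a pair. -/
noncomputable def edgeVector {V : Type*} (e : V × V) : V → ℝ := by
  classical exact Pi.single e.1 1 - Pi.single e.2 1

/-- Summing coordinates over the class of `(e j).1` is a linear functional that kills the edge
vectors of all related pairs, but equals 1 on that of pair `j` if its ends are unrelated. -/
theorem rel_iff_edgeVector_mem_span {V J : Type*} [Fintype V] (S : Setoid V) (e : J → V × V)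
    (j : J) :
    S (e j).1 (e j).2 ↔ edgeVector (e j) ∈ Submodule.span ℝ
      (Set.range fun i : {i // S (e i).1 (e i).2} => edgeVector (e i)) := by
  classical
  constructor
  · intro h
    exact Submodule.subset_span ⟨⟨j, h⟩, rfl⟩
  · intro h
    let φ : (V → ℝ) →ₗ[ℝ] ℝ := ∑ x : V, ind (S (e j).1 x) • LinearMap.proj x
    have hφ : ∀ p : V × V, φ (edgeVector p) = ind (S (e j).1 p.1) - ind (S (e j).1 p.2) := by
      intro p
      simp [φ, edgeVector, Pi.single_apply, mul_sub, Finset.sum_sub_distrib]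
    have hle : Submodule.span ℝ
        (Set.range fun i : {i // S (e i).1 (e i).2} => edgeVector (e i)) ≤ LinearMap.ker φ := by
      rw [Submodule.span_le]
      rintro _ ⟨⟨i, hi⟩, rfl⟩
      have h1 : S (e j).1 (e i).1 ↔ S (e j).1 (e i).2 :=
        ⟨fun h => S.trans h hi, fun h => S.trans h (S.symm hi)⟩
      simp [hφ, h1]
    have h2 := hle h
    rw [LinearMap.mem_ker, hφ, ind_of (S.refl _)] at h2
    by_contra h3
    rw [ind_of_not h3] at h2
    norm_num at h2

/-- An equivalence relation is determined on a family of pairs by at most `|V|` of them. -/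
theorem exists_spanning_subset {V J : Type*} [Fintype V] [DecidableEq J] (S : Setoid V)
    (e : J → V × V) :
    ∃ T : Finset J, T.card ≤ Fintype.card V ∧ ∀ j, S (e j).1 (e j).2 ↔
      edgeVector (e j) ∈ Submodule.span ℝ ((fun i => edgeVector (e i)) '' (T : Set J)) := by
  -- `T` indexes a basis chosen among the edge vectors of related pairs; the dimension of `V → ℝ`
  -- bounds its size.
  obtain ⟨κ, a, -, hspan, hli⟩ := exists_linearIndependent' ℝ
    fun i : {i // S (e i).1 (e i).2} => edgeVector (e i)
  have hfin : Finite κ := hli.finite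
  have := Fintype.ofFinite κ
  refine ⟨Finset.univ.image fun k => (a k : J), ?_, fun j => ?_⟩
  · refine Finset.card_image_le.trans ?_
    have := hli.fintype_card_le_finrank
    simpa using this
  · rw [rel_iff_edgeVector_mem_span S e j, ← hspan]
    have : (fun i => edgeVector (e i)) '' ((Finset.univ.image fun k => (a k : J) : Finset J) : Set J)
        = Set.range ((fun i : {i // S (e i).1 (e i).2} => edgeVector (e i)) ∘ a) := by
      ext v
      simp
    rw [this]

/-- Each small set `T` contributes `x ^ T.card ≥ x ^ n` to the binomial expansion of `(1 + x) ^
Fintype.card J`. -/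
theorem card_filter_card_le {J : Type*} [Fintype J] [DecidableEq J] (n : ℕ) {x : ℝ} (hx0 : 0 < x)
    (hx1 : x ≤ 1) :
    (((Finset.univ : Finset (Finset J)).filter fun T => T.card ≤ n).card : ℝ)
      ≤ (1 + x) ^ Fintype.card J / x ^ n := by
  rw [le_div_iff₀ (by positivity)]
  have h := Finset.sum_pow_mul_eq_add_pow x 1 (Finset.univ : Finset J)
  rw [Finset.card_univ, add_comm] at h
  rw [← h, Finset.powerset_univ, ← nsmul_eq_mul, ← Finset.sum_const]
  refine (Finset.sum_le_sum fun T hT => ?_).trans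
    (Finset.sum_le_sum_of_subset_of_nonneg (Finset.filter_subset _ _) fun T _ _ => by positivity)
  rw [one_pow, mul_one]
  exact pow_le_pow_of_le_one hx0.le hx1 (Finset.mem_filter.1 hT).2

/-- The errors of a classifier. -/
def lossOf {V : Type*} (h : Classifier V) (z : Sample V) : Bool := decide (h z.1 ≠ z.2)

/-- The growth function of the classifiers of equivalence relations, for pairs of samples. -/
theorem exists_lossPatterns {V κ : Type*} [Fintype V] [Fintype κ] [DecidableEq κ]
    (t : κ → Sample V × Sample V) {x : ℝ} (hx0 : 0 < x) (hx1 : x ≤ 1) :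
    ∃ U : Finset (κ → Bool × Bool),
      (U.card : ℝ) ≤ Real.exp (4 * x * Fintype.card κ) / x ^ Fintype.card V ∧
      ∀ (h : Classifier V) (S : Setoid V),
        (∀ q, h q = pairLabel (S q.1 q.2.1) (S q.1 q.2.2)) →
        (fun i => (lossOf h (t i).1, lossOf h (t i).2)) ∈ U := by
  let z : κ → Bool → Sample V := fun i b => if b then (t i).1 else (t i).2
  -- Two samples per index and two pairs per query: the first bit selects the sample, the second the
  -- pair `(x, y)` or `(x, z)`.
  let e : κ × Bool × Bool → V × V := fun j =>
    ((z j.1 j.2.1).1.1, if j.2.2 then (z j.1 j.2.1).1.2.1 else (z j.1 j.2.1).1.2.2)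
  let R : Finset (κ × Bool × Bool) → κ × Bool × Bool → Prop := fun T j =>
    edgeVector (e j) ∈ Submodule.span ℝ
      ((fun i => edgeVector (e i)) '' (T : Set (κ × Bool × Bool)))
  -- A decoder: the losses are recovered from the spanning set `T` alone.
  let ψ : Finset (κ × Bool × Bool) → κ → Bool → Bool := fun T i b =>
    decide (pairLabel (R T (i, b, true)) (R T (i, b, false)) ≠ (z i b).2)
  refine ⟨((Finset.univ : Finset (Finset (κ × Bool × Bool))).filter
    fun T => T.card ≤ Fintype.card V).image fun T i => (ψ T i true, ψ T i false), ?_, ?_⟩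
  · refine (Nat.cast_le.2 Finset.card_image_le).trans ((card_filter_card_le _ hx0 hx1).trans ?_)
    refine div_le_div_of_nonneg_right ?_ (by positivity)
    have h1 : (Fintype.card (κ × Bool × Bool)) = Fintype.card κ * 4 := by
      simp [Fintype.card_prod]
    rw [h1]
    calc (1 + x) ^ (Fintype.card κ * 4) ≤ Real.exp x ^ (Fintype.card κ * 4) := by
          gcongr
          linarith [Real.add_one_le_exp x]
      _ = _ := by
          rw [← Real.exp_nat_mul]
          congr 1
          push_cast
          ring
  · intro h S hS
    obtain ⟨T, hT, hTS⟩ := exists_spanning_subset S e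
    refine Finset.mem_image.2 ⟨T, by simpa using hT, ?_⟩
    have h2 : ∀ i b, ψ T i b = lossOf h (z i b) := by
      intro i b
      have h3 : R T (i, b, true) = S (z i b).1.1 (z i b).1.2.1 :=
        propext (hTS (i, b, true)).symm
      have h4 : R T (i, b, false) = S (z i b).1.1 (z i b).1.2.2 :=
        propext (hTS (i, b, false)).symm
      simp only [ψ, lossOf, hS, h3, h4]
    funext i
    simp only [h2]
    simp [z]

end Growth

/-! ### Uniform deviation bounds -/

section Deviation

set_option linter.unusedSectionVars false

variable {κ Ω : Type*} [Fintype κ] [DecidableEq κ] [Fintype Ω]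

theorem sum_eq_card_mul_empRate [Nonempty κ] (g : Ω → Bool) (s : κ → Ω) :
    ∑ i, (if g (s i) then (1 : ℝ) else 0) = Fintype.card κ * empRate g s := by
  have hκ : (Fintype.card κ : ℝ) ≠ 0 := by exact_mod_cast Fintype.card_ne_zero
  rw [empRate, mul_div_cancel₀ _ hκ]

theorem empRate_nonneg (g : Ω → Bool) (s : κ → Ω) : 0 ≤ empRate g s :=
  div_nonneg (Finset.sum_nonneg fun i _ => by split_ifs <;> norm_num) (by positivity)

/-- Uniform one-sided deviation of the empirical frequencies from the probabilities. -/
theorem sum_deviation_le [Nonempty κ] {p : Ω → ℝ} (hp0 : ∀ ω, 0 ≤ p ω) (hp : ∑ ω, p ω = 1)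
    (G : Set (Ω → Bool)) {N l : ℝ} (hl : 0 < l)
    (hN : ∀ t : κ → Ω × Ω, ∃ U : Finset (κ → Bool × Bool), (U.card : ℝ) ≤ N ∧
      ∀ g ∈ G, (fun i => (g (t i).1, g (t i).2)) ∈ U) :
    l * ∑ s : κ → Ω, tupleWeight p s * ind (∃ g ∈ G, empRate g s + 2 * l < trueRate p g)
      ≤ N * Real.exp (-(Fintype.card κ * l ^ 2 / 2)) := by
  let v : Bool → ℝ := fun b => if b then 1 else 0
  -- An exponential moment: averaging over the swap gives at most `cosh l ≤ exp (l ^ 2 / 2)`. A gap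
  -- of `2 * l` leaves more than `l` between the two samples, hence `r`.
  have h := mul_sum_bad_le (κ := κ) hp0 hp G (fun a b => Real.exp (l * (v b - v a)))
    (fun a b => (Real.exp_pos _).le) (M := Real.exp (l ^ 2 / 2)) (N := N)
    (r := Real.exp (Fintype.card κ * l ^ 2)) (η := l) ?_ (Real.exp_pos _) hN
    (fun g s => empRate g s + 2 * l < trueRate p g) ?_
  · refine h.trans (le_of_eq ?_)
    rw [mul_div_assoc, ← Real.exp_nat_mul, ← Real.exp_sub]
    congr 2
    ring
  · have h1 : Real.exp l + Real.exp (-l) ≤ 2 * Real.exp (l ^ 2 / 2) := by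
      have := Real.cosh_le_exp_half_sq l
      rw [Real.cosh_eq] at this
      linarith
    have h2 : 1 ≤ Real.exp (l ^ 2 / 2) := Real.one_le_exp (by positivity)
    intro a b
    cases a <;> cases b <;> simp [v] <;> linarith
  · intro g _ s hs
    refine ⟨by linarith [empRate_nonneg g s], fun s' hs' => ?_⟩
    rw [← Real.exp_sum, Real.exp_le_exp, ← Finset.mul_sum, Finset.sum_sub_distrib,
      sum_eq_card_mul_empRate, sum_eq_card_mul_empRate, ← mul_sub]
    have : (Fintype.card κ : ℝ) * l ≤ Fintype.card κ * (empRate g s' - empRate g s) :=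
      mul_le_mul_of_nonneg_left (by linarith) (by positivity)
    nlinarith

/-- Uniformly over `G`, an event that does not occur in the sample is unlikely. -/
theorem sum_consistent_le [Nonempty κ] {p : Ω → ℝ} (hp0 : ∀ ω, 0 ≤ p ω) (hp : ∑ ω, p ω = 1)
    (G : Set (Ω → Bool)) {N ε : ℝ} (hε : 0 < ε)
    (hN : ∀ t : κ → Ω × Ω, ∃ U : Finset (κ → Bool × Bool), (U.card : ℝ) ≤ N ∧
      ∀ g ∈ G, (fun i => (g (t i).1, g (t i).2)) ∈ U) :
    ε / 2 * ∑ s : κ → Ω, tupleWeight p s * ind (∃ g ∈ G, (∀ i, g (s i) = false) ∧ ε < trueRate p g)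
      ≤ N * Real.exp (-(Fintype.card κ * ε / 2 * Real.log 2)) := by
  -- An occurrence in the sample is forbidden, one in the ghost sample counts twice; the swap
  -- average is still at most 1, while more than `ε / 2` of the ghost draws are hits.
  let w : Bool → Bool → ℝ := fun a b => if a then 0 else if b then 2 else 1
  have h := mul_sum_bad_le (κ := κ) hp0 hp G w
    (fun a b => by cases a <;> cases b <;> simp [w]) (M := 1) (N := N)
    (r := Real.exp (Fintype.card κ * ε / 2 * Real.log 2)) (η := ε / 2)
    (fun a b => by cases a <;> cases b <;> norm_num [w]) (Real.exp_pos _) hN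
    (fun g s => (∀ i, g (s i) = false) ∧ ε < trueRate p g) ?_
  · refine h.trans (le_of_eq ?_)
    rw [one_pow, mul_one, Real.exp_neg, div_eq_mul_inv]
  · rintro g _ s ⟨hs, hg⟩
    refine ⟨by linarith, fun s' hs' => ?_⟩
    have h1 : ∀ i, w (g (s i)) (g (s' i)) = Real.exp ((if g (s' i) then 1 else 0) * Real.log 2) := by
      intro i
      rw [hs i]
      cases g (s' i)
      · simp [w]
      · simp [w, Real.exp_log]
    simp only [h1]
    rw [← Real.exp_sum, Real.exp_le_exp, ← Finset.sum_mul, sum_eq_card_mul_empRate]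
    refine mul_le_mul_of_nonneg_right ?_ (Real.log_nonneg (by norm_num))
    rw [mul_div_assoc]
    exact mul_le_mul_of_nonneg_left (by linarith) (by positivity)

end Deviation

/-! ### Empirical risk minimization and learnability -/

section Measures

set_option linter.unusedSectionVars false

variable {V : Type*} [Fintype V] [MeasurableSpace V] [DiscreteMeasurableSpace V]

instance : Fintype (Sample V) := inferInstanceAs (Fintype ((V × V × V) × TripleLabel))

theorem real_eq_sum_ind {Ω : Type*} [Fintype Ω] [MeasurableSpace Ω] [MeasurableSingletonClass Ω]
    (D : Measure Ω) [IsFiniteMeasure D] (E : Set Ω) :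
    D.real E = ∑ z, D.real {z} * ind (z ∈ E) := by
  classical
  have h : E = ((Finset.univ.filter fun z => z ∈ E : Finset Ω) : Set Ω) := by ext; simp
  conv_lhs => rw [h]
  rw [← sum_measureReal_singleton, Finset.sum_filter]
  refine Finset.sum_congr rfl fun z _ => ?_
  by_cases hz : z ∈ E
  · simp [hz, ind_of]
  · simp [hz, ind_of_not]

theorem sum_real_singleton {Ω : Type*} [Fintype Ω] [MeasurableSpace Ω]
    [MeasurableSingletonClass Ω] (D : Measure Ω) [IsProbabilityMeasure D] :
    ∑ z, D.real {z} = 1 := by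
  simp

theorem pi_real_eq_sum {Ω : Type*} [Fintype Ω] [MeasurableSpace Ω]
    [MeasurableSingletonClass Ω] (D : Measure Ω) [IsProbabilityMeasure D] {k : ℕ}
    (E : Set (Fin k → Ω)) :
    (Measure.pi fun _ : Fin k => D).real E
      = ∑ s, tupleWeight (fun z => D.real {z}) s * ind (s ∈ E) := by
  rw [real_eq_sum_ind]
  refine Finset.sum_congr rfl fun s _ => ?_
  congr 1
  rw [measureReal_def, Measure.pi_singleton, ENNReal.toReal_prod]
  rfl

theorem errorRate_eq_trueRate (D : Measure (Sample V)) [IsProbabilityMeasure D]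
    (h : Classifier V) : errorRate D h = trueRate (fun z => D.real {z}) (lossOf h) := by
  rw [errorRate, real_eq_sum_ind]
  refine Finset.sum_congr rfl fun z _ => ?_
  by_cases hz : h z.1 = z.2
  · rw [ind_of_not (by simpa using hz)]
    simp [lossOf, hz]
  · rw [ind_of (by simpa using hz)]
    simp [lossOf, hz]

theorem exists_errorRate_le_optimalError (H : Set (Classifier V)) (hH : H.Nonempty)
    (D : Measure (Sample V)) : ∃ h ∈ H, errorRate D h ≤ optimalError H D := by
  obtain ⟨h, hh, hmin⟩ := Set.exists_min_image H (errorRate D) H.toFinite hH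
  have : Nonempty H := hH.to_subtype
  exact ⟨h, hh, le_ciInf fun g => hmin g g.2⟩

/-- Empirical risk minimization. -/
theorem exists_empiricalMinimizer (H : Set (Classifier V)) (hH : H.Nonempty) (k : ℕ) :
    ∃ A : (Fin k → Sample V) → Classifier V, (∀ s, A s ∈ H) ∧
      ∀ s, ∀ h ∈ H, empRate (lossOf (A s)) s ≤ empRate (lossOf h) s := by
  choose A hA hmin using fun s : Fin k → Sample V =>
    Set.exists_min_image H (fun h => empRate (lossOf h) s) H.toFinite hH
  exact ⟨A, hA, hmin⟩

theorem one_sub_le_pi_real (D : Measure (Sample V)) [IsProbabilityMeasure D] {k : ℕ} {δ : ℝ}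
    (E : Set (Fin k → Sample V))
    (h : ∑ s, tupleWeight (fun z => D.real {z}) s * ind (s ∉ E) ≤ δ) :
    1 - δ ≤ (Measure.pi fun _ : Fin k => D).real E := by
  rw [pi_real_eq_sum]
  have h1 : ∑ s : Fin k → Sample V, tupleWeight (fun z => D.real {z}) s * ind (s ∈ E) +
      ∑ s, tupleWeight (fun z => D.real {z}) s * ind (s ∉ E) = 1 := by
    rw [← Finset.sum_add_distrib, ← sum_tupleWeight (κ := Fin k) (sum_real_singleton D)]
    refine Finset.sum_congr rfl fun s _ => ?_
    by_cases hs : s ∈ E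
    · rw [ind_of hs, ind_of_not (not_not.2 hs)]
      ring
    · rw [ind_of_not hs, ind_of hs]
      ring
  linarith

theorem realizableLearnable_of_le (H F : Set (Classifier V)) (hH : H.Nonempty) (hHF : H ⊆ F)
    (hS : ∀ h ∈ H, ∃ S : Setoid V, ∀ q, h q = pairLabel (S q.1 q.2.1) (S q.1 q.2.2))
    {ε δ x : ℝ} (hε : 0 < ε) (hx0 : 0 < x) (hx1 : x ≤ 1) {k : ℕ} (hk : 0 < k)
    (hbound : Real.exp (4 * x * k) / x ^ Fintype.card V *
      Real.exp (-(k * ε / 2 * Real.log 2)) ≤ ε / 2 * δ) :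
    RealizableLearnable H F ε δ k := by
  obtain ⟨A, hA, hmin⟩ := exists_empiricalMinimizer H hH k
  refine ⟨A, fun s => hHF (hA s), fun D hD ⟨h, hh, hh0⟩ => ?_⟩
  have : Nonempty (Fin k) := ⟨⟨0, hk⟩⟩
  have hdev := sum_consistent_le (κ := Fin k) (p := fun z => D.real {z})
    (fun _ => measureReal_nonneg) (sum_real_singleton D) (lossOf '' H) hε
    (N := Real.exp (4 * x * k) / x ^ Fintype.card V) fun t => by
      obtain ⟨U, hU, hUS⟩ := exists_lossPatterns t hx0 hx1
      rw [Fintype.card_fin] at hU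
      refine ⟨U, hU, ?_⟩
      rintro _ ⟨h, hh, rfl⟩
      obtain ⟨S, hSh⟩ := hS h hh
      exact hUS h S hSh
  rw [Fintype.card_fin] at hdev
  refine one_sub_le_pi_real D _ ((Finset.sum_le_sum fun s _ => ?_).trans
    (le_of_mul_le_mul_left (hdev.trans hbound) (by positivity)))
  by_cases hs : ∀ i, lossOf h (s i) = false
  · refine mul_le_mul_of_nonneg_left (ind_mono fun hE => ⟨_, ⟨A s, hA s, rfl⟩, ?_, ?_⟩)
      (tupleWeight_nonneg (fun _ => measureReal_nonneg) s)
    · have h1 := hmin s h hh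
      have h2 : empRate (lossOf h) s = 0 := by simp [empRate, hs]
      rw [h2] at h1
      have h3 := sum_eq_card_mul_empRate (lossOf (A s)) s
      rw [le_antisymm h1 (empRate_nonneg _ _), mul_zero,
        Finset.sum_eq_zero_iff_of_nonneg fun i _ => by split_ifs <;> norm_num] at h3
      intro i
      have := h3 i (Finset.mem_univ i)
      by_contra h4
      simp [h4] at this
    · rw [← errorRate_eq_trueRate]
      simpa using hE
  · push Not at hs
    obtain ⟨i, hi⟩ := hs
    -- A sample contradicting the error-free `h` contains a point of mass zero.
    have h0 : tupleWeight (fun z => D.real {z}) s = 0 := by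
      refine Finset.prod_eq_zero (Finset.mem_univ i) ?_
      refine le_antisymm ?_ measureReal_nonneg
      rw [← hh0]
      refine measureReal_mono ?_
      simpa [lossOf] using hi
    rw [h0, zero_mul, zero_mul]

theorem empRate_not {κ Ω : Type*} [Fintype κ] [Nonempty κ] (g : Ω → Bool) (s : κ → Ω) :
    empRate (fun z => !g z) s = 1 - empRate g s := by
  have hκ : (Fintype.card κ : ℝ) ≠ 0 := by exact_mod_cast Fintype.card_ne_zero
  rw [eq_sub_iff_add_eq, empRate, empRate, ← add_div, ← Finset.sum_add_distrib,
    div_eq_one_iff_eq hκ]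
  have : ∀ i, ((if (!g (s i)) = true then (1 : ℝ) else 0) + if g (s i) = true then 1 else 0) = 1 := by
    intro i
    cases g (s i) <;> simp
  rw [Finset.sum_congr rfl fun i _ => this i]
  simp

theorem trueRate_not {Ω : Type*} [Fintype Ω] {p : Ω → ℝ} (hp : ∑ ω, p ω = 1) (g : Ω → Bool) :
    trueRate p (fun z => !g z) = 1 - trueRate p g := by
  rw [eq_sub_iff_add_eq, trueRate, trueRate, ← Finset.sum_add_distrib]
  refine Eq.trans ?_ hp
  refine Finset.sum_congr rfl fun z _ => ?_
  cases g z <;> simp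

theorem agnosticLearnable_of_le (H F : Set (Classifier V)) (hH : H.Nonempty) (hHF : H ⊆ F)
    (hS : ∀ h ∈ H, ∃ S : Setoid V, ∀ q, h q = pairLabel (S q.1 q.2.1) (S q.1 q.2.2))
    {ε δ x : ℝ} (hε : 0 < ε) (hx0 : 0 < x) (hx1 : x ≤ 1) {k : ℕ} (hk : 0 < k)
    (hbound : (Real.exp (4 * x * k) / x ^ Fintype.card V + 1) *
      Real.exp (-(k * (ε / 4) ^ 2 / 2)) ≤ ε / 4 * δ) :
    AgnosticLearnable H F ε δ k := by
  obtain ⟨A, hA, hmin⟩ := exists_empiricalMinimizer H hH k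
  refine ⟨A, fun s => hHF (hA s), fun D hD => ?_⟩
  have : Nonempty (Fin k) := ⟨⟨0, hk⟩⟩
  obtain ⟨h, hh, hopt⟩ := exists_errorRate_le_optimalError H hH D
  have hp0 : ∀ z : Sample V, 0 ≤ D.real {z} := fun _ => measureReal_nonneg
  have hdev := sum_deviation_le (κ := Fin k) (p := fun z => D.real {z})
    hp0 (sum_real_singleton D) (lossOf '' H) (l := ε / 4) (by positivity)
    (N := Real.exp (4 * x * k) / x ^ Fintype.card V) fun t => by
      obtain ⟨U, hU, hUS⟩ := exists_lossPatterns t hx0 hx1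
      rw [Fintype.card_fin] at hU
      refine ⟨U, hU, ?_⟩
      rintro _ ⟨h, hh, rfl⟩
      obtain ⟨S, hSh⟩ := hS h hh
      exact hUS h S hSh
  -- The opposite deviation is needed only for the one optimal `h`: complementing its loss reverses
  -- the inequality, and a single pattern suffices. This is the `+ 1` in `hbound`.
  have hdev' := sum_deviation_le (κ := Fin k) (p := fun z => D.real {z})
    hp0 (sum_real_singleton D) {fun z => !lossOf h z} (l := ε / 4) (by positivity)
    (N := 1) fun t => ⟨{fun i => (!lossOf h (t i).1, !lossOf h (t i).2)}, by simp, by simp⟩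
  rw [Fintype.card_fin] at hdev hdev'
  have hsum := (add_le_add hdev hdev').trans (le_trans (by rw [← add_mul]) hbound)
  rw [← mul_add] at hsum
  refine one_sub_le_pi_real D _ (le_trans ?_ (le_of_mul_le_mul_left hsum (by positivity)))
  rw [← Finset.sum_add_distrib]
  refine Finset.sum_le_sum fun s _ => ?_
  rw [← mul_add]
  refine mul_le_mul_of_nonneg_left ?_ (tupleWeight_nonneg hp0 s)
  by_cases h1 : ∃ g ∈ lossOf '' H, empRate g s + 2 * (ε / 4) < trueRate (fun z => D.real {z}) g
  · rw [ind_of h1]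
    have h2 := ind_mono fun _ :
      s ∉ {s | errorRate D (A s) ≤ optimalError H D + ε} => trivial
    rw [ind_of trivial] at h2
    linarith [ind_nonneg (∃ g ∈ ({fun z => !lossOf h z} : Set (Sample V → Bool)),
      empRate g s + 2 * (ε / 4) < trueRate (fun z => D.real {z}) g)]
  · rw [ind_of_not h1, zero_add]
    refine ind_mono fun hE => ⟨_, rfl, ?_⟩
    rw [empRate_not, trueRate_not (sum_real_singleton D)]
    have h2 : trueRate (fun z => D.real {z}) (lossOf (A s))
        ≤ empRate (lossOf (A s)) s + 2 * (ε / 4) :=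
      not_lt.1 fun h3 => h1 ⟨_, ⟨A s, hA s, rfl⟩, h3⟩
    have h3 := hmin s h hh
    rw [Set.mem_ofPred_eq, not_le, errorRate_eq_trueRate] at hE
    rw [errorRate_eq_trueRate] at hopt
    linarith

end Measures

/-! ### Le Cam's inequality and Assouad's lemma -/

section Assouad

set_option linter.unusedSectionVars false

variable {Ω ι : Type*} [Fintype Ω] [Fintype ι] [DecidableEq ι]

/-- Le Cam's inequality: the overlap of two distributions is at least half of the square of their
Hellinger affinity. -/
theorem sq_affinity_le {P Q : Ω → ℝ} (hP : ∀ ω, 0 ≤ P ω) (hQ : ∀ ω, 0 ≤ Q ω)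
    (hP1 : ∑ ω, P ω = 1) (hQ1 : ∑ ω, Q ω = 1) :
    (∑ ω, √(P ω * Q ω)) ^ 2 ≤ 2 * ∑ ω, min (P ω) (Q ω) := by
  have h1 : ∀ ω, √(P ω * Q ω) = √(min (P ω) (Q ω)) * √(max (P ω) (Q ω)) := fun ω => by
    rw [← Real.sqrt_mul (le_min (hP ω) (hQ ω)), min_mul_max]
  -- Cauchy–Schwarz for `P Q = min · max`; the maxima sum to at most 2.
  have h2 := Finset.sum_mul_sq_le_sq_mul_sq Finset.univ (fun ω => √(min (P ω) (Q ω)))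
    fun ω => √(max (P ω) (Q ω))
  simp only [← h1, Real.sq_sqrt (le_min (hP _) (hQ _)),
    Real.sq_sqrt (le_max_of_le_left (hP _))] at h2
  have h3 : ∑ ω, max (P ω) (Q ω) ≤ 2 := by
    calc ∑ ω, max (P ω) (Q ω) ≤ ∑ ω, (P ω + Q ω) := Finset.sum_le_sum fun ω _ =>
          max_le (by linarith [hQ ω]) (by linarith [hP ω])
      _ = 2 := by rw [Finset.sum_add_distrib, hP1, hQ1]; norm_num
  have h4 : 0 ≤ ∑ ω, min (P ω) (Q ω) := Finset.sum_nonneg fun ω _ => le_min (hP ω) (hQ ω)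
  nlinarith

/-- Affinity is multiplicative over independent draws, so Bernoulli's inequality keeps its square at
least `1 - 2kγ ≥ 1/2`. -/
theorem quarter_le_sum_min {P Q : Ω → ℝ} (hP : ∀ ω, 0 ≤ P ω) (hQ : ∀ ω, 0 ≤ Q ω)
    (hP1 : ∑ ω, P ω = 1) (hQ1 : ∑ ω, Q ω = 1) {γ : ℝ} (hγ : γ ≤ 1)
    (haff : 1 - γ ≤ ∑ ω, √(P ω * Q ω)) {k : ℕ} (hk : 4 * k * γ ≤ 1) :
    1 / 4 ≤ ∑ s : Fin k → Ω, min (tupleWeight P s) (tupleWeight Q s) := by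
  have h1 := sq_affinity_le (tupleWeight_nonneg (κ := Fin k) hP) (tupleWeight_nonneg hQ)
    (sum_tupleWeight hP1) (sum_tupleWeight hQ1)
  have h2 : ∀ s : Fin k → Ω, √(tupleWeight P s * tupleWeight Q s) = ∏ i, √(P (s i) * Q (s i)) := by
    intro s
    rw [tupleWeight, tupleWeight, ← Finset.prod_mul_distrib, Real.sqrt_eq_rpow,
      ← Real.finsetProd_rpow _ _ fun i _ => mul_nonneg (hP _) (hQ _)]
    simp only [Real.sqrt_eq_rpow]
  simp only [h2] at h1
  rw [sum_prod_apply fun _ ω => √(P ω * Q ω), Finset.prod_const, Finset.card_univ,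
    Fintype.card_fin, ← pow_mul] at h1
  have h3 : 1 - 2 * k * γ ≤ (1 - γ) ^ (k * 2) := by
    have := one_add_mul_le_pow (a := -γ) (by linarith) (k * 2)
    push_cast at this
    rw [← sub_eq_add_neg] at this
    linarith
  have h4 : (1 - γ) ^ (k * 2) ≤ (∑ ω, √(P ω * Q ω)) ^ (k * 2) :=
    pow_le_pow_left₀ (by linarith) haff _
  linarith

/-- Flip one bit. -/
def flipBit (i : ι) (b : ι → Bool) : ι → Bool := Function.update b i (!b i)

theorem flipBit_involutive (i : ι) : Function.Involutive (flipBit i) := by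
  intro b
  simp [flipBit]

/-- Assouad's lemma for the Hellinger affinity. -/
theorem exists_le_expected_errors (P : (ι → Bool) → Ω → ℝ) (hP : ∀ b ω, 0 ≤ P b ω)
    (hP1 : ∀ b, ∑ ω, P b ω = 1) {γ : ℝ} (hγ : γ ≤ 1)
    (haff : ∀ b i, 1 - γ ≤ ∑ ω, √(P b ω * P (flipBit i b) ω)) {k : ℕ} (hk : 4 * k * γ ≤ 1)
    (err : ι → Bool → (Fin k → Ω) → Prop) (herr : ∀ i c s, err i c s ∨ err i (!c) s) :
    ∃ b, (Fintype.card ι : ℝ) / 8 ≤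
      ∑ s : Fin k → Ω, tupleWeight (P b) s * ∑ i, ind (err i (b i) s) := by
  -- Pair `b` with `flipBit i b`: any decoder errs on bit `i` for one of the two, so their error
  -- probabilities add up to at least the overlap `1/4`.
  have h1 : ∀ i, ∑ _b : ι → Bool, (1 / 8 : ℝ) ≤
      ∑ b : ι → Bool, ∑ s : Fin k → Ω, tupleWeight (P b) s * ind (err i (b i) s) := by
    intro i
    have h2 := Equiv.sum_comp (flipBit_involutive i).toPerm
      fun b => ∑ s : Fin k → Ω, tupleWeight (P b) s * ind (err i (b i) s)
    have h3 : ∀ b : ι → Bool, (1 / 4 : ℝ) ≤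
        ∑ s : Fin k → Ω, tupleWeight (P b) s * ind (err i (b i) s) +
        ∑ s : Fin k → Ω, tupleWeight (P (flipBit i b)) s * ind (err i (flipBit i b i) s) := by
      intro b
      refine (quarter_le_sum_min (hP b) (hP (flipBit i b)) (hP1 _) (hP1 _) hγ (haff b i) hk).trans ?_
      rw [← Finset.sum_add_distrib]
      refine Finset.sum_le_sum fun s _ => ?_
      have h4 : flipBit i b i = !b i := by simp [flipBit]
      have h5 := tupleWeight_nonneg (hP b) s
      have h6 := tupleWeight_nonneg (hP (flipBit i b)) s
      rw [h4]
      rcases herr i (b i) s with h | h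
      · rw [ind_of h, mul_one]
        exact (min_le_left _ _).trans (le_add_of_nonneg_right (mul_nonneg h6 (ind_nonneg _)))
      · rw [ind_of h, mul_one]
        exact (min_le_right _ _).trans (le_add_of_nonneg_left (mul_nonneg h5 (ind_nonneg _)))
    have h7 := Finset.sum_le_sum fun b (_ : b ∈ Finset.univ) => h3 b
    rw [Finset.sum_add_distrib] at h7
    simp only [Function.Involutive.coe_toPerm] at h2
    rw [h2] at h7
    have h8 : ∑ _b : ι → Bool, (1 / 4 : ℝ) = 2 * ∑ _b : ι → Bool, (1 / 8 : ℝ) := by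
      rw [Finset.mul_sum]
      norm_num
    linarith
  have h9 : ∑ _b : ι → Bool, (Fintype.card ι : ℝ) / 8 ≤
      ∑ b : ι → Bool, ∑ s : Fin k → Ω, tupleWeight (P b) s * ∑ i, ind (err i (b i) s) := by
    calc ∑ _b : ι → Bool, (Fintype.card ι : ℝ) / 8 = ∑ _i : ι, ∑ _b : ι → Bool, (1 / 8 : ℝ) := by
          simp only [Finset.sum_const, Finset.card_univ, nsmul_eq_mul]
          ring
      _ ≤ ∑ i, ∑ b : ι → Bool, ∑ s : Fin k → Ω, tupleWeight (P b) s * ind (err i (b i) s) :=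
          Finset.sum_le_sum fun i _ => h1 i
      _ = _ := by
          rw [Finset.sum_comm]
          refine Finset.sum_congr rfl fun b _ => ?_
          rw [Finset.sum_comm]
          simp only [Finset.mul_sum]
  obtain ⟨b, -, hb⟩ := Finset.exists_le_of_sum_le Finset.univ_nonempty h9
  exact ⟨b, hb⟩

end Assouad

/-! ### Noisy bit distributions and their affinity -/

section HardDistributions

set_option linter.unusedSectionVars false

variable {ι : Type*} [Fintype ι] [DecidableEq ι]

/-- Mass `1 - θ` is put on `none`, the remaining mass is uniform on `ι`, where the bit `b i` is
observed with bias `α`. -/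
noncomputable def noisyBits (θ α : ℝ) (b : ι → Bool) : Option ι × Bool → ℝ
  | (none, _) => (1 - θ) / 2
  | (some i, c) => θ / Fintype.card ι * if c = b i then (1 + α) / 2 else (1 - α) / 2

theorem noisyBits_nonneg {θ α : ℝ} (hθ0 : 0 ≤ θ) (hθ1 : θ ≤ 1) (hα0 : 0 ≤ α) (hα1 : α ≤ 1)
    (b : ι → Bool) (ω : Option ι × Bool) : 0 ≤ noisyBits θ α b ω := by
  rcases ω with ⟨_ | i, c⟩
  · simp only [noisyBits]
    linarith
  · simp only [noisyBits]
    refine mul_nonneg (by positivity) ?_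
    split_ifs <;> linarith

theorem sum_option_prod_bool (f : Option ι × Bool → ℝ) :
    ∑ ω, f ω = f (none, true) + f (none, false) + ∑ i, (f (some i, true) + f (some i, false)) := by
  rw [Fintype.sum_prod_type, Fintype.sum_option]
  simp

theorem sum_noisyBits [Nonempty ι] (θ α : ℝ) (b : ι → Bool) : ∑ ω, noisyBits θ α b ω = 1 := by
  have hι : (Fintype.card ι : ℝ) ≠ 0 := by exact_mod_cast Fintype.card_ne_zero
  have h : ∀ i, noisyBits θ α b (some i, true) + noisyBits θ α b (some i, false)
      = θ / Fintype.card ι := by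
    intro i
    simp only [noisyBits]
    cases b i <;> simp <;> ring
  rw [sum_option_prod_bool]
  simp only [h]
  rw [Finset.sum_const, Finset.card_univ, nsmul_eq_mul, mul_div_cancel₀ _ hι]
  simp only [noisyBits]
  ring

/-- Only the atoms over `i` change; their affinity is `θ / |ι|` times `√(1 - α²) ≥ 1 - α²`. -/
theorem affinity_noisyBits [Nonempty ι] {θ α : ℝ} (hθ0 : 0 ≤ θ) (hθ1 : θ ≤ 1) (hα0 : 0 ≤ α)
    (hα1 : α ≤ 1) (b : ι → Bool) (i : ι) :
    1 - θ * α ^ 2 / Fintype.card ι ≤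
      ∑ ω, √(noisyBits θ α b ω * noisyBits θ α (flipBit i b) ω) := by
  have hι : (Fintype.card ι : ℝ) ≠ 0 := by exact_mod_cast Fintype.card_ne_zero
  have hd : 0 ≤ θ / Fintype.card ι := by positivity
  have hsqrt : 1 - α ^ 2 ≤ 2 * √((1 + α) / 2 * ((1 - α) / 2)) := by
    have h1 : (1 - α ^ 2) / 2 ≤ √((1 + α) / 2 * ((1 - α) / 2)) := by
      refine Real.le_sqrt_of_sq_le ?_
      have : 0 ≤ 1 - α ^ 2 := by nlinarith
      nlinarith [sq_nonneg α]
    linarith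
  have hj : ∀ j, θ / Fintype.card ι - (if j = i then θ * α ^ 2 / Fintype.card ι else 0) ≤
      √(noisyBits θ α b (some j, true) * noisyBits θ α (flipBit i b) (some j, true)) +
      √(noisyBits θ α b (some j, false) * noisyBits θ α (flipBit i b) (some j, false)) := by
    intro j
    by_cases hji : j = i
    · subst hji
      have h1 : ∀ x y : ℝ, √(θ / Fintype.card ι * x * (θ / Fintype.card ι * y))
          = θ / Fintype.card ι * √(x * y) := by
        intro x y
        rw [show θ / Fintype.card ι * x * (θ / Fintype.card ι * y)
          = (θ / Fintype.card ι) ^ 2 * (x * y) by ring, Real.sqrt_mul (sq_nonneg _),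
          Real.sqrt_sq hd]
      have h2 : θ / Fintype.card ι - θ * α ^ 2 / Fintype.card ι
          = θ / Fintype.card ι * (1 - α ^ 2) := by ring
      have h3 := mul_le_mul_of_nonneg_left hsqrt hd
      rw [if_pos rfl, h2]
      simp only [noisyBits, h1, flipBit, Function.update_self]
      cases b j <;> simp [mul_comm ((1 - α) / 2)] <;> linarith
    · have h1 : ∀ c, noisyBits θ α (flipBit i b) (some j, c) = noisyBits θ α b (some j, c) := by
        intro c
        simp [noisyBits, flipBit, hji]
      rw [if_neg hji, h1, h1, Real.sqrt_mul_self (noisyBits_nonneg hθ0 hθ1 hα0 hα1 b _),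
        Real.sqrt_mul_self (noisyBits_nonneg hθ0 hθ1 hα0 hα1 b _)]
      simp only [noisyBits]
      cases b j <;> simp <;> linarith
  have hsum := Finset.sum_le_sum fun j (_ : j ∈ Finset.univ) => hj j
  rw [Finset.sum_sub_distrib, Finset.sum_const, Finset.card_univ, nsmul_eq_mul,
    mul_div_cancel₀ _ hι, Finset.sum_ite_eq' Finset.univ i, if_pos (Finset.mem_univ i)] at hsum
  rw [sum_option_prod_bool]
  have h0 : ∀ c, √(noisyBits θ α b (none, c) * noisyBits θ α (flipBit i b) (none, c))
      = (1 - θ) / 2 := fun c => by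
    simp only [noisyBits]
    exact Real.sqrt_mul_self (by linarith)
  rw [h0, h0]
  linarith

/-- A probability measure with given point weights. -/
theorem exists_measure_of_weights {Ω : Type*} [Fintype Ω] [MeasurableSpace Ω]
    [MeasurableSingletonClass Ω] {p : Ω → ℝ} (hp : ∀ ω, 0 ≤ p ω) (hp1 : ∑ ω, p ω = 1) :
    ∃ D : Measure Ω, IsProbabilityMeasure D ∧ ∀ ω, D.real {ω} = p ω := by
  let P : PMF Ω := PMF.ofFintype (fun ω => ENNReal.ofReal (p ω)) (by
    rw [← ENNReal.ofReal_sum_of_nonneg fun ω _ => hp ω, hp1, ENNReal.ofReal_one])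
  refine ⟨P.toMeasure, inferInstance, fun ω => ?_⟩
  rw [measureReal_def, P.toMeasure_apply_singleton _ (measurableSet_singleton ω)]
  simp [P, ENNReal.toReal_ofReal (hp ω)]

end HardDistributions

/-! ### From undetermined bits to excess error -/

section LowerBound

variable {V ι : Type*} [Fintype V] [MeasurableSpace V] [DiscreteMeasurableSpace V]
  [Fintype ι] [DecidableEq ι]

/-- The label that encodes a bit. -/
def bitLabel (c : Bool) : TripleLabel := if c then TripleLabel.first else TripleLabel.equal

/-- The labelled sample that encodes a noisy bit. -/
def bitSample (q : ι → Query V) (q₀ : Query V) : Option ι × Bool → Sample V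
  | (none, _) => (q₀, TripleLabel.equal)
  | (some i, c) => (q i, bitLabel c)

instance : MeasurableSpace (Option ι × Bool) := ⊤

/-- If `k` samples are few, then no algorithm learns all the noisy bit distributions. -/
theorem exists_hard_distribution [Nonempty ι] (q : ι → Query V) (q₀ : Query V) {θ α ε δ : ℝ}
    (hθ0 : 0 ≤ θ) (hθ1 : θ ≤ 1) (hα0 : 0 ≤ α) (hα1 : α ≤ 1) (hε : 0 < ε) (hθα : θ * α = 16 * ε)
    (hδ : δ ≤ 1 / 32) {k : ℕ} (hk : 4 * k * (θ * α ^ 2) ≤ Fintype.card ι)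
    (A : (Fin k → Sample V) → Classifier V) :
    ∃ (b : ι → Bool) (D : Measure (Sample V)), IsProbabilityMeasure D ∧
      (∀ h : Classifier V, h q₀ = TripleLabel.equal → (∀ i, h (q i) = bitLabel (b i)) →
        errorRate D h = θ * ((1 - α) / 2)) ∧
      (Measure.pi fun _ : Fin k => D).real {s | errorRate D (A s) ≤ θ * ((1 - α) / 2) + ε}
        < 1 - δ := by
  have hι : (0 : ℝ) < Fintype.card ι := by exact_mod_cast Fintype.card_pos
  let emb := bitSample q q₀
  have hθα2 : θ * α ^ 2 ≤ 1 := by nlinarith [mul_nonneg hθ0 hα0, pow_le_one₀ (n := 2) hα0 hα1]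
  obtain ⟨b, hb⟩ := exists_le_expected_errors (noisyBits θ α)
    (noisyBits_nonneg hθ0 hθ1 hα0 hα1) (sum_noisyBits θ α)
    (γ := θ * α ^ 2 / Fintype.card ι)
    (div_le_one_of_le₀ (hθα2.trans (by exact_mod_cast Fintype.card_pos)) hι.le)
    (affinity_noisyBits hθ0 hθ1 hα0 hα1) (k := k)
    (by rw [mul_div_assoc', div_le_one hι]; exact hk)
    (fun i c s => A (fun j => emb (s j)) (q i) ≠ bitLabel c) (by
      intro i c s
      by_contra! h
      have := h.1.symm.trans h.2
      cases c <;> simp [bitLabel] at this)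
  obtain ⟨P, hP, hPw⟩ := exists_measure_of_weights
    (noisyBits_nonneg hθ0 hθ1 hα0 hα1 b) (sum_noisyBits θ α b)
  have hmeas : Measurable emb := .of_discrete
  have hD : IsProbabilityMeasure (P.map emb) := Measure.isProbabilityMeasure_map hmeas.aemeasurable
  have herr : ∀ h : Classifier V, errorRate (P.map emb) h =
      (1 - θ) * ind (h q₀ ≠ TripleLabel.equal) + ∑ i, θ / Fintype.card ι *
        ((1 + α) / 2 * ind (h (q i) ≠ bitLabel (b i)) +
          (1 - α) / 2 * ind (h (q i) ≠ bitLabel (!b i))) := by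
    intro h
    rw [errorRate, map_measureReal_apply hmeas .of_discrete, real_eq_sum_ind, sum_option_prod_bool]
    simp only [hPw, noisyBits]
    congr 1
    · change (1 - θ) / 2 * ind (h q₀ ≠ TripleLabel.equal) +
        (1 - θ) / 2 * ind (h q₀ ≠ TripleLabel.equal) = _
      ring
    · refine Finset.sum_congr rfl fun i _ => ?_
      change _ * ind (h (q i) ≠ bitLabel true) + _ * ind (h (q i) ≠ bitLabel false) = _
      cases b i <;> simp <;> ring
  -- Each wrong bit costs `θ * α / |ι|` above the unavoidable noise.
  have hlow : ∀ h : Classifier V, θ * ((1 - α) / 2) +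
      θ * α / Fintype.card ι * ∑ i, ind (h (q i) ≠ bitLabel (b i))
        ≤ errorRate (P.map emb) h := by
    intro h
    rw [herr]
    have h1 : ∀ i, θ / Fintype.card ι * ((1 - α) / 2) +
        θ * α / Fintype.card ι * ind (h (q i) ≠ bitLabel (b i)) ≤ θ / Fintype.card ι *
        ((1 + α) / 2 * ind (h (q i) ≠ bitLabel (b i)) +
          (1 - α) / 2 * ind (h (q i) ≠ bitLabel (!b i))) := by
      intro i
      have h2 : θ / Fintype.card ι * ((1 - α) / 2) +
          θ * α / Fintype.card ι * ind (h (q i) ≠ bitLabel (b i)) = θ / Fintype.card ι *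
          ((1 - α) / 2 + α * ind (h (q i) ≠ bitLabel (b i))) := by ring
      rw [h2]
      refine mul_le_mul_of_nonneg_left ?_ (by positivity)
      by_cases h3 : h (q i) = bitLabel (b i)
      · have h4 : h (q i) ≠ bitLabel (!b i) := by
          rw [h3]
          cases b i <;> simp [bitLabel]
        rw [ind_of h4, ind_of_not (not_not.2 h3)]
        linarith
      · rw [ind_of h3]
        nlinarith [ind_nonneg (h (q i) ≠ bitLabel (!b i))]
    have h2 := Finset.sum_le_sum fun i (_ : i ∈ Finset.univ) => h1 i
    rw [Finset.sum_add_distrib, Finset.sum_const, Finset.card_univ, nsmul_eq_mul, ← Finset.mul_sum,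
      ← mul_assoc, mul_div_cancel₀ _ hι.ne'] at h2
    nlinarith [ind_nonneg (h q₀ ≠ TripleLabel.equal)]
  refine ⟨b, P.map emb, hD, fun h h0 hq => ?_, ?_⟩
  · rw [herr, ind_of_not (not_not.2 h0)]
    have h1 : ∀ i, ind (h (q i) ≠ bitLabel (b i)) = 0 := fun i => ind_of_not (not_not.2 (hq i))
    have h2 : ∀ i, ind (h (q i) ≠ bitLabel (!b i)) = 1 := fun i => ind_of (by
      rw [hq]
      cases b i <;> simp [bitLabel])
    simp only [h1, h2]
    rw [Finset.sum_const, Finset.card_univ, nsmul_eq_mul]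
    field_simp
    ring
  · have hmeas' : Measurable fun (x : Fin k → Option ι × Bool) i => emb (x i) := .of_discrete
    rw [← Measure.pi_map_pi fun _ => hmeas.aemeasurable,
      map_measureReal_apply hmeas' .of_discrete, pi_real_eq_sum]
    simp only [hPw]
    set E : Set (Fin k → Option ι × Bool) := (fun x i => emb (x i)) ⁻¹'
      {s | errorRate (P.map emb) (A s) ≤ θ * ((1 - α) / 2) + ε} with hE
    -- As `θ * α = 16 * ε`, success allows at most `|ι| / 16` wrong bits. With `|ι| / 8` wrong on
    -- average, success has probability at most `14/15 < 31/32`.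
    have h1 : ∀ s : Fin k → Option ι × Bool,
        ∑ i, ind (A (fun j => emb (s j)) (q i) ≠ bitLabel (b i)) ≤
          Fintype.card ι - Fintype.card ι * (15 / 16) * ind (s ∈ E) := by
      intro s
      by_cases hs : s ∈ E
      · rw [ind_of hs]
        have h2 := hlow (A fun j => emb (s j))
        have h3 : errorRate (P.map emb) (A fun j => emb (s j)) ≤ θ * ((1 - α) / 2) + ε := hs
        have h4 := h2.trans h3
        rw [hθα, add_le_add_iff_left, div_mul_eq_mul_div, div_le_iff₀ hι] at h4
        have h5 : ε * (16 * ∑ i, ind (A (fun j => emb (s j)) (q i) ≠ bitLabel (b i)))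
            ≤ ε * Fintype.card ι := by linarith
        have := le_of_mul_le_mul_left h5 hε
        linarith
      · rw [ind_of_not hs, mul_zero, sub_zero]
        refine (Finset.sum_le_sum fun i _ => ind_mono fun _ => trivial).trans ?_
        simp [ind_of trivial]
    have h2 := hb.trans (Finset.sum_le_sum fun s _ => mul_le_mul_of_nonneg_left (h1 s)
      (tupleWeight_nonneg (noisyBits_nonneg hθ0 hθ1 hα0 hα1 b) s))
    simp only [mul_sub, Finset.sum_sub_distrib, ← Finset.sum_mul,
      sum_tupleWeight (sum_noisyBits θ α b)] at h2
    have h3 : ∑ s : Fin k → Option ι × Bool, tupleWeight (noisyBits θ α b) s *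
        (Fintype.card ι * (15 / 16) * ind (s ∈ E)) = Fintype.card ι * (15 / 16) *
        ∑ s : Fin k → Option ι × Bool, tupleWeight (noisyBits θ α b) s * ind (s ∈ E) := by
      rw [Finset.mul_sum]
      exact Finset.sum_congr rfl fun s _ => by ring
    rw [h3] at h2
    by_contra h4
    push Not at h4
    have h5 : (Fintype.card ι : ℝ) * (15 / 16) * (31 / 32) ≤ Fintype.card ι * (15 / 16) *
        ∑ s : Fin k → Option ι × Bool, tupleWeight (noisyBits θ α b) s * ind (s ∈ E) :=
      mul_le_mul_of_nonneg_left (by linarith) (by positivity)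
    linarith

end LowerBound

/-! ### Shattered queries -/

section Shattering

variable {V : Type*}

/-- The partition into `A`, its complement and `m - 2` empty classes. -/
def twoClasses (m : ℕ) (A : Set V) (i : Fin m) : Set V :=
  if i.val = 0 then A else if i.val = 1 then Aᶜ else ∅

theorem isClassPartition_twoClasses {m : ℕ} (hm : 2 ≤ m) (A : Set V) :
    IsClassPartition (twoClasses m A) := by
  refine ⟨fun i j hij => ?_, Set.eq_univ_of_forall fun v => Set.mem_iUnion.2 ?_⟩
  · have hij' : i.val ≠ j.val := fun h => hij (Fin.ext h)
    rw [Set.disjoint_left]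
    intro v hi hj
    simp only [twoClasses] at hi hj
    split_ifs at hi hj <;> simp_all
  · by_cases hv : v ∈ A
    · exact ⟨⟨0, by omega⟩, by simpa [twoClasses] using hv⟩
    · exact ⟨⟨1, by omega⟩, by simpa [twoClasses] using hv⟩

theorem twoClasses_rel {m : ℕ} (hm : 2 ≤ m) {A : Set V} {x : V} (hx : x ∈ A) (y : V) :
    (∃ i, x ∈ twoClasses m A i ∧ y ∈ twoClasses m A i) ↔ y ∈ A := by
  constructor
  · rintro ⟨i, h1, h2⟩
    simp only [twoClasses] at h1 h2
    split_ifs at h1 h2 <;> simp_all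
  · intro hy
    exact ⟨⟨0, by omega⟩, by simpa [twoClasses] using ⟨hx, hy⟩⟩

theorem exists_twoClasses_mem {H : Set (Classifier V)}
    (hH : H = nonemptyClassHypotheses V ∨ ∃ m : ℕ, 2 ≤ m ∧ H = classHypotheses V m)
    {A : Set V} (hA : A.Nonempty) (hA' : Aᶜ.Nonempty) :
    ∃ m, 2 ≤ m ∧ distClassifier (classDist (twoClasses m A)) ∈ H := by
  rcases hH with rfl | ⟨m, hm, rfl⟩
  · refine ⟨2, le_rfl, 2, le_rfl, _, isClassPartition_twoClasses le_rfl A, fun i => ?_, rfl⟩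
    fin_cases i
    · simpa [twoClasses] using hA
    · simpa [twoClasses] using hA'
  · exact ⟨m, hm, _, isClassPartition_twoClasses hm A, rfl⟩

/-- The queries `(x, x, y)` with `y ≠ x, z` are shattered by the labels `first` and `equal`. -/
theorem exists_mem_of_bits {H : Set (Classifier V)}
    (hH : H = nonemptyClassHypotheses V ∨ ∃ m : ℕ, 2 ≤ m ∧ H = classHypotheses V m)
    {x z : V} (hxz : x ≠ z) (b : {y : V // y ≠ x ∧ y ≠ z} → Bool) :
    ∃ h ∈ H, h (x, x, x) = TripleLabel.equal ∧
      ∀ y : {y : V // y ≠ x ∧ y ≠ z}, h (x, x, y) = bitLabel (b y) := by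
  -- The class of `x`: a bit `true` separates `y` from `x`. Keeping `z` outside makes both classes
  -- nonempty.
  let A : Set V := {v | v ≠ z ∧ ∀ hv : v ≠ x ∧ v ≠ z, b ⟨v, hv⟩ = false}
  have hx : x ∈ A := ⟨hxz, fun hv => absurd rfl hv.1⟩
  have hz : z ∈ Aᶜ := fun h => h.1 rfl
  obtain ⟨m, hm, hmem⟩ := exists_twoClasses_mem hH ⟨x, hx⟩ ⟨z, hz⟩
  refine ⟨_, hmem, ?_, fun y => ?_⟩
  · rw [distClassifier_classDist]
    simp only [twoClasses_rel hm hx]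
    simp [pairLabel, hx]
  · rw [distClassifier_classDist]
    simp only [twoClasses_rel hm hx]
    have hy : (y : V) ∈ A ↔ b y = false :=
      ⟨fun h => h.2 y.2, fun h => ⟨y.2.2, fun _ => h⟩⟩
    cases hb : b y <;> simp [pairLabel, hx, hy, hb, bitLabel]

theorem exists_setoid_of_mem {H : Set (Classifier V)}
    (hH : H = nonemptyClassHypotheses V ∨ ∃ m : ℕ, 2 ≤ m ∧ H = classHypotheses V m) :
    ∀ h ∈ H, ∃ S : Setoid V, ∀ q, h q = pairLabel (S q.1 q.2.1) (S q.1 q.2.2) := by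
  rcases hH with rfl | ⟨m, hm, rfl⟩
  · rintro _ ⟨m, -, C, hC, -, rfl⟩
    exact exists_setoid_of_isClassPartition hC
  · rintro _ ⟨C, hC, rfl⟩
    exact exists_setoid_of_isClassPartition hC

theorem nonempty_hypotheses [Fintype V] {H : Set (Classifier V)} (hV : 3 ≤ Fintype.card V)
    (hH : H = nonemptyClassHypotheses V ∨ ∃ m : ℕ, 2 ≤ m ∧ H = classHypotheses V m) :
    H.Nonempty := by
  obtain ⟨x, z, hxz⟩ := Fintype.exists_pair_of_one_lt_card (show 1 < Fintype.card V by omega)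
  obtain ⟨h, hh, -⟩ := exists_mem_of_bits hH hxz fun _ => true
  exact ⟨h, hh⟩

end Shattering

/-! ### Numerical sample sizes -/

section SampleSizes

theorem log_one_div_nonneg {ε : ℝ} (h0 : 0 < ε) (h1 : ε < 1) : 0 ≤ Real.log (1 / ε) :=
  Real.log_nonneg (by rw [le_div_iff₀ h0]; linarith)

theorem exp_div_pow_mul_exp_le {n k : ℕ} {x y z : ℝ} (hx : 0 < x) (hz : 0 < z)
    (h : 4 * x * k + n * Real.log (1 / x) + Real.log (1 / z) ≤ y) :
    Real.exp (4 * x * k) / x ^ n * Real.exp (-y) ≤ z := by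
  have h1 : x ^ n = Real.exp (-(n * Real.log (1 / x))) := by
    rw [one_div, Real.log_inv, mul_neg, neg_neg, mul_comm, Real.exp_mul, Real.exp_log hx,
      Real.rpow_natCast]
  have h2 : z = Real.exp (-Real.log (1 / z)) := by
    rw [one_div, Real.log_inv, neg_neg, Real.exp_log hz]
  rw [h1, h2, ← Real.exp_sub, ← Real.exp_add, Real.exp_le_exp]
  linarith

theorem log_one_div_div {K x : ℝ} (hK : 0 < K) (hx : 0 < x) :
    Real.log (1 / (x / K)) = Real.log K + Real.log (1 / x) := by
  rw [← Real.log_mul hK.ne' (by positivity)]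
  congr 1
  field_simp

theorem log_two_pow_le (m : ℕ) : Real.log (2 ^ m) ≤ m * 0.6931471808 := by
  rw [Real.log_pow]
  exact mul_le_mul_of_nonneg_left Real.log_two_lt_d9.le (by positivity)

/-- With `x = ε / 32` the growth term is `kε / 8`, well below the exponent `(log 2 / 2) kε`; the
remainder pays for the logarithms. -/
theorem realizable_sampleSize {n k : ℕ} (hn : 1 ≤ n) {ε δ : ℝ} (hε0 : 0 < ε) (hε1 : ε < 1)
    (hδ0 : 0 < δ) (hδ1 : δ < 1)
    (hk : 32 * (n / ε) * ((1 + Real.log (1 / ε)) * (1 + Real.log (1 / δ))) ≤ k) :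
    Real.exp (4 * (ε / 32) * k) / (ε / 32) ^ n * Real.exp (-(k * ε / 2 * Real.log 2))
      ≤ ε / 2 * δ := by
  refine exp_div_pow_mul_exp_le (by positivity) (by positivity) ?_
  have hL := log_one_div_nonneg hε0 hε1
  have hL' := log_one_div_nonneg hδ0 hδ1
  have h32 : Real.log 32 ≤ 4 := by
    have := log_two_pow_le 5
    norm_num at this ⊢
    linarith
  have h2 : Real.log 2 ≤ 1 := by linarith [Real.log_two_lt_d9]
  have h1 : Real.log (1 / (ε / 2 * δ)) = Real.log 2 + Real.log (1 / ε) + Real.log (1 / δ) := by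
    rw [← Real.log_mul (by norm_num) (by positivity), ← Real.log_mul (by positivity) (by positivity)]
    congr 1
    field_simp
  rw [log_one_div_div (by norm_num) hε0, h1]
  have hn' : (1 : ℝ) ≤ n := by exact_mod_cast hn
  have hk' : 32 * n * ((1 + Real.log (1 / ε)) * (1 + Real.log (1 / δ))) ≤ k * ε := by
    have := mul_le_mul_of_nonneg_right hk hε0.le
    refine le_trans (le_of_eq ?_) this
    field_simp
  generalize Real.log (1 / ε) = L at *
  generalize Real.log (1 / δ) = L' at *
  have h3 : (k * ε : ℝ) * 0.69 ≤ k * ε * Real.log 2 :=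
    mul_le_mul_of_nonneg_left (by linarith [Real.log_two_gt_d9]) (by positivity)
  have h4 : 0 ≤ n * L := by positivity
  have h5 : 0 ≤ n * L' := by positivity
  have h6 : 0 ≤ n * (L * L') := by positivity
  have h7 : L ≤ n * L := le_mul_of_one_le_left hL hn'
  have h8 : L' ≤ n * L' := le_mul_of_one_le_left hL' hn'
  have h9 : n * Real.log 32 ≤ n * 4 := mul_le_mul_of_nonneg_left h32 (by positivity)
  nlinarith

/-- With `x = ε ^ 2 / 256` growth uses half of the exponent `kε² / 32`. The other half is at least
`576 / 64 = 9` times `n` and the logarithmic factors, and the constants needed are `6 + 3`. -/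
theorem agnostic_sampleSize {n k : ℕ} (hn : 1 ≤ n) {ε δ : ℝ} (hε0 : 0 < ε) (hε1 : ε < 1)
    (hδ0 : 0 < δ) (hδ1 : δ < 1)
    (hk : 576 * (n / ε ^ 2) * ((1 + Real.log (1 / ε)) * (1 + Real.log (1 / δ))) ≤ k) :
    (Real.exp (4 * (ε ^ 2 / 256) * k) / (ε ^ 2 / 256) ^ n + 1) *
      Real.exp (-(k * (ε / 4) ^ 2 / 2)) ≤ ε / 4 * δ := by
  have hx1 : ε ^ 2 / 256 ≤ 1 := by nlinarith
  have hge : 1 ≤ Real.exp (4 * (ε ^ 2 / 256) * k) / (ε ^ 2 / 256) ^ n := by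
    rw [le_div_iff₀ (by positivity), one_mul]
    exact (pow_le_one₀ (by positivity) hx1).trans (Real.one_le_exp (by positivity))
  have hmain : Real.exp (4 * (ε ^ 2 / 256) * k) / (ε ^ 2 / 256) ^ n *
      Real.exp (-(k * (ε / 4) ^ 2 / 2)) ≤ ε / 8 * δ := by
    refine exp_div_pow_mul_exp_le (by positivity) (by positivity) ?_
    have hL := log_one_div_nonneg hε0 hε1
    have hL' := log_one_div_nonneg hδ0 hδ1
    have h256 : Real.log 256 ≤ 6 := by
      have := log_two_pow_le 8
      norm_num at this ⊢
      linarith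
    have h8 : Real.log 8 ≤ 3 := by
      have := log_two_pow_le 3
      norm_num at this ⊢
      linarith
    have h1 : Real.log (1 / (ε / 8 * δ)) = Real.log 8 + Real.log (1 / ε) + Real.log (1 / δ) := by
      rw [← Real.log_mul (by norm_num) (by positivity),
        ← Real.log_mul (by positivity) (by positivity)]
      congr 1
      field_simp
    have h2 : Real.log (1 / ε ^ 2) = 2 * Real.log (1 / ε) := by
      rw [← one_div_pow, Real.log_pow]
      norm_num
    rw [log_one_div_div (by norm_num) (by positivity), h1, h2]
    have hn' : (1 : ℝ) ≤ n := by exact_mod_cast hn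
    have hk' : 576 * n * ((1 + Real.log (1 / ε)) * (1 + Real.log (1 / δ))) ≤ k * ε ^ 2 := by
      have := mul_le_mul_of_nonneg_right hk (sq_nonneg ε)
      refine le_trans (le_of_eq ?_) this
      field_simp
    generalize Real.log (1 / ε) = L at *
    generalize Real.log (1 / δ) = L' at *
    have h4 : 0 ≤ n * L := by positivity
    have h5 : 0 ≤ n * L' := by positivity
    have h6 : 0 ≤ n * (L * L') := by positivity
    have h7 : L ≤ n * L := le_mul_of_one_le_left hL hn'
    have h8 : L' ≤ n * L' := le_mul_of_one_le_left hL' hn'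
    have h9 : n * Real.log 256 ≤ n * 6 := mul_le_mul_of_nonneg_left h256 (by positivity)
    nlinarith
  calc _ ≤ (2 * (Real.exp (4 * (ε ^ 2 / 256) * k) / (ε ^ 2 / 256) ^ n)) *
        Real.exp (-(k * (ε / 4) ^ 2 / 2)) :=
        mul_le_mul_of_nonneg_right (by linarith) (Real.exp_pos _).le
    _ ≤ ε / 4 * δ := by linarith

theorem exists_isLeast_le_two_mul {P : ℕ → Prop} {y : ℝ} (hy : 1 ≤ y)
    (h : ∀ k : ℕ, 0 < k → y ≤ k → P k) : ∃ s : ℕ, IsLeast {k | P k} s ∧ (s : ℝ) ≤ 2 * y := by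
  classical
  have hP : P ⌈y⌉₊ := h _ (Nat.ceil_pos.2 (by linarith)) (Nat.le_ceil y)
  refine ⟨Nat.find ⟨_, hP⟩, ⟨Nat.find_spec _, fun k hk => Nat.find_min' _ hk⟩, ?_⟩
  calc ((Nat.find ⟨_, hP⟩ : ℕ) : ℝ) ≤ (⌈y⌉₊ : ℝ) := by exact_mod_cast Nat.find_min' ⟨_, hP⟩ hP
    _ ≤ 2 * y := by linarith [Nat.ceil_lt_add_one (show 0 ≤ y by linarith)]

end SampleSizes

/-! ### Lower bounds on the sample complexities -/

section SampleComplexity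

variable {V : Type*} [Fintype V] [MeasurableSpace V] [DiscreteMeasurableSpace V]
  {H F : Set (Classifier V)} {ε δ : ℝ} {k : ℕ}

theorem not_learnable_of_few_samples (hV : 3 ≤ Fintype.card V)
    (hH : H = nonemptyClassHypotheses V ∨ ∃ m : ℕ, 2 ≤ m ∧ H = classHypotheses V m)
    {θ α : ℝ} (hθ0 : 0 ≤ θ) (hθ1 : θ ≤ 1) (hα0 : 0 ≤ α) (hα1 : α ≤ 1) (hε : 0 < ε)
    (hθα : θ * α = 16 * ε) (hδ : δ ≤ 1 / 32)
    (hk : 12 * k * (θ * α ^ 2) ≤ Fintype.card V) (A : (Fin k → Sample V) → Classifier V) :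
    ∃ D : Measure (Sample V), IsProbabilityMeasure D ∧
      (∃ h ∈ H, errorRate D h = θ * ((1 - α) / 2)) ∧
      (Measure.pi fun _ : Fin k => D).real {s | errorRate D (A s) ≤ θ * ((1 - α) / 2) + ε}
        < 1 - δ := by
  classical
  obtain ⟨x, z, hxz⟩ := Fintype.exists_pair_of_one_lt_card (show 1 < Fintype.card V by omega)
  have hcard : Fintype.card {y : V // y ≠ x ∧ y ≠ z} = Fintype.card V - 2 := by
    rw [Fintype.card_subtype, ← Finset.card_univ, ← Finset.card_pair hxz,
      ← Finset.card_sdiff_of_subset (Finset.subset_univ _)]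
    congr 1
    ext y
    simp
  have hne : Nonempty {y : V // y ≠ x ∧ y ≠ z} := Fintype.card_pos_iff.1 (by omega)
  -- Two points are spent on `x` and `z`; this is where `|V| ≥ 3` enters and `4` becomes `12`.
  have hcard3 : (Fintype.card V : ℝ) ≤ 3 * Fintype.card {y : V // y ≠ x ∧ y ≠ z} := by
    have : Fintype.card V ≤ 3 * Fintype.card {y : V // y ≠ x ∧ y ≠ z} := by omega
    exact_mod_cast this
  obtain ⟨b, D, hD, herr, hlt⟩ := exists_hard_distribution
    (fun y : {y : V // y ≠ x ∧ y ≠ z} => ((x, x, (y : V)) : Query V)) (x, x, x)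
    hθ0 hθ1 hα0 hα1 hε hθα hδ (k := k) (by linarith) A
  obtain ⟨h, hh, h0, hb⟩ := exists_mem_of_bits hH hxz b
  exact ⟨D, hD, ⟨h, hh, herr h h0 hb⟩, hlt⟩

theorem le_of_realizableLearnable (hV : 3 ≤ Fintype.card V)
    (hH : H = nonemptyClassHypotheses V ∨ ∃ m : ℕ, 2 ≤ m ∧ H = classHypotheses V m)
    (hε0 : 0 < ε) (hε : ε ≤ 1 / 32) (hδ : δ ≤ 1 / 32) (h : RealizableLearnable H F ε δ k) :
    1 / 3072 * (Fintype.card V / ε) ≤ k := by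
  obtain ⟨A, -, hA⟩ := h
  by_contra! hk
  obtain ⟨D, hD, hopt, hlt⟩ := not_learnable_of_few_samples (k := k) hV hH (θ := 16 * ε) (α := 1)
    (by positivity) (by linarith) zero_le_one le_rfl hε0 (by ring) hδ (by
      rw [mul_div_assoc', lt_div_iff₀ hε0] at hk
      nlinarith [show (0 : ℝ) ≤ k * ε by positivity]) A
  simp only [sub_self, zero_div, mul_zero, zero_add] at hopt hlt
  exact absurd (hA D hD hopt) (not_le.2 hlt)

theorem le_of_agnosticLearnable (hV : 3 ≤ Fintype.card V)
    (hH : H = nonemptyClassHypotheses V ∨ ∃ m : ℕ, 2 ≤ m ∧ H = classHypotheses V m)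
    (hε0 : 0 < ε) (hε : ε ≤ 1 / 32) (hδ : δ ≤ 1 / 32) (h : AgnosticLearnable H F ε δ k) :
    1 / 3072 * (Fintype.card V / ε ^ 2) ≤ k := by
  obtain ⟨A, -, hA⟩ := h
  by_contra! hk
  obtain ⟨D, hD, ⟨h, hh, hopt⟩, hlt⟩ := not_learnable_of_few_samples (k := k) hV hH (θ := 1)
    (α := 16 * ε) zero_le_one le_rfl (by positivity) (by linarith) hε0 (by ring) hδ (by
      rw [mul_div_assoc', lt_div_iff₀ (by positivity)] at hk
      nlinarith) A
  refine absurd (hA D hD) (not_le.2 (lt_of_le_of_lt (measureReal_mono fun s hs => ?_) hlt))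
  -- An upper bound on the optimum suffices: a smaller optimum only makes success harder.
  have h1 : optimalError H D ≤ errorRate D h :=
    ciInf_le ⟨0, by rintro _ ⟨g, rfl⟩; exact measureReal_nonneg⟩ (⟨h, hh⟩ : H)
  rw [hopt] at h1
  have h2 : errorRate D (A s) ≤ optimalError H D + ε := hs
  exact h2.trans (by linarith)

theorem one_le_sampleSize {n x ε δ : ℝ} (hn : 1 ≤ n) (hx0 : 0 < x) (hx1 : x ≤ 1) (hε0 : 0 < ε)
    (hε1 : ε < 1) (hδ0 : 0 < δ) (hδ1 : δ < 1) :
    1 ≤ n / x * ((1 + Real.log (1 / ε)) * (1 + Real.log (1 / δ))) := by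
  have h1 : 1 ≤ n / x := by
    rw [le_div_iff₀ hx0]
    linarith
  have h2 := log_one_div_nonneg hε0 hε1
  have h3 := log_one_div_nonneg hδ0 hδ1
  exact one_le_mul_of_one_le_of_one_le h1
    (one_le_mul_of_one_le_of_one_le (by linarith) (by linarith))

end SampleComplexity

end Contrastive

/-! ### The theorem -/

theorem mainTheorem10 :
    ∃ (c C ε₀ δ₀ : ℝ) (a : ℕ), 0 < c ∧ 0 < C ∧ 0 < ε₀ ∧ ε₀ < 1 ∧ 0 < δ₀ ∧ δ₀ < 1 ∧
      ∀ (V : Type u) [Fintype V] [MeasurableSpace V] [DiscreteMeasurableSpace V],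
        3 ≤ Fintype.card V →
        ∀ H : Set (Classifier V),
          (H = nonemptyClassHypotheses V ∨ ∃ m : ℕ, 2 ≤ m ∧ H = classHypotheses V m) →
        ∀ F : Set (Classifier V), H ⊆ F →
        ∀ ε δ : ℝ, 0 < ε → ε < 1 → 0 < δ → δ < 1 →
          (∃ s : ℕ, IsRealizableSampleComplexity H F ε δ s ∧
            (s : ℝ) ≤ C * (Fintype.card V / ε) *
              ((1 + Real.log (1 / ε)) * (1 + Real.log (1 / δ))) ^ a ∧
            (ε ≤ ε₀ → δ ≤ δ₀ → c * (Fintype.card V / ε) ≤ (s : ℝ))) ∧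
          (∃ s : ℕ, IsAgnosticSampleComplexity H F ε δ s ∧
            (s : ℝ) ≤ C * (Fintype.card V / ε ^ 2) *
              ((1 + Real.log (1 / ε)) * (1 + Real.log (1 / δ))) ^ a ∧
            (ε ≤ ε₀ → δ ≤ δ₀ → c * (Fintype.card V / ε ^ 2) ≤ (s : ℝ))) := by
  -- `3072 = 12 * 16 ^ 2` and `1152 = 2 * 576` come from the agnostic case; the realizable case
  -- needs less.
  refine ⟨1 / 3072, 1152, 1 / 32, 1 / 32, 1, by norm_num, by norm_num, by norm_num, by norm_num,
    by norm_num, by norm_num, ?_⟩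
  intro V _ _ _ hV H hH F hHF ε δ hε0 hε1 hδ0 hδ1
  have hn : 1 ≤ Fintype.card V := by omega
  have hn' : (1 : ℝ) ≤ Fintype.card V := by exact_mod_cast hn
  have hne := nonempty_hypotheses hV hH
  have hS := exists_setoid_of_mem hH
  have hε2 : ε ^ 2 ≤ 1 := pow_le_one₀ hε0.le hε1.le
  constructor
  · have hy := one_le_sampleSize hn' hε0 hε1.le hε0 hε1 hδ0 hδ1
    obtain ⟨s, hs, hle⟩ := exists_isLeast_le_two_mul
      (P := RealizableLearnable H F ε δ)
      (y := 32 * (Fintype.card V / ε) * ((1 + Real.log (1 / ε)) * (1 + Real.log (1 / δ))))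
      (by linarith) fun k hk0 hk =>
        realizableLearnable_of_le H F hne hHF hS hε0 (by positivity) (by linarith) hk0
          (realizable_sampleSize hn hε0 hε1 hδ0 hδ1 hk)
    refine ⟨s, hs, ?_, fun h1 h2 => le_of_realizableLearnable hV hH hε0 h1 h2 hs.1⟩
    rw [pow_one]
    linarith
  · have hy := one_le_sampleSize hn' (pow_pos hε0 2) hε2 hε0 hε1 hδ0 hδ1
    obtain ⟨s, hs, hle⟩ := exists_isLeast_le_two_mul
      (P := AgnosticLearnable H F ε δ)
      (y := 576 * (Fintype.card V / ε ^ 2) * ((1 + Real.log (1 / ε)) * (1 + Real.log (1 / δ))))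
      (by linarith) fun k hk0 hk =>
        agnosticLearnable_of_le H F hne hHF hS hε0 (by positivity) (by linarith) hk0
          (agnostic_sampleSize hn hε0 hε1 hδ0 hδ1 hk)
    refine ⟨s, hs, ?_, fun h1 h2 => le_of_agnosticLearnable hV hH hε0 h1 h2 hs.1⟩
    rw [pow_one]
    linarith
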